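/- **Proposition 7.5.** Let $M$ be a compact smooth manifold of dimension $2n+1$. For a contact form $\lambda$ on $M$ (a smooth one-form with $\lambda\wedge(d\lambda)^n$ nowhere zero) let $R_\lambda$ be its Reeb vector field, let $\mu_\lambda=\lambda\wedge(d\lambda)^n$, and denote by $\mu_\lambda$ also the measure induced by this volume form. Let $\mathfrak C_1(M)$ be the set of contact forms with $\mu_\lambda(M)=1$, with tangent space $T_\lambda\mathfrak C_1(M)=\{\alpha\in\Omega^1(M): \int_M\alpha(R_\lambda)\,d\mu_\lambda=0\}$. A contact form $\lambda$ is *non-projectible* if the only $H\in C^\infty(M)$ with $R_\lambda[H]=0$ and $\int_M H\,d\mu_\lambda=0$ is $H=0$. A *strict contact pair* is a pair $(\lambda,\psi)$ of $\lambda\in\mathfrak C_1(M)$ and a diffeomorphism $\psi$ of $M$ with $\psi^*\lambda=\lambda$. Put $\theta^\pi=\theta-\theta(R_\lambda)\lambda$ for one-forms $\theta$, and consider $\Phi(\lambda,\psi)=(\psi^*\lambda)^\pi$ on the space $\mathfrak{Diff}_1(M,\mu)$ of all pairs of $\lambda\in\mathfrak C_1(M)$ and a diffeomorphism $\psi$ with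 $\psi^*\mu_\lambda=\mu_\lambda$. The strict contact pairs form the set $\Phi^{-1}(0)$. The tangent space $T_{(\lambda,\psi)}\mathfrak{Diff}_1(M,\mu)$ consists of the pairs $(\alpha,X)$ of $\alpha\in T_\lambda\mathfrak C_1(M)$ and a smooth vector field $X$ (representing the variation $X\circ\psi$ of $\psi$) which satisfy the linearized equation $$\psi^*(\delta_\alpha\mu_\lambda+\mathcal L_X\mu_\lambda)=\delta_\alpha\mu_\lambda,\qquad \delta_\alpha\mu_\lambda=\tfrac{d}{dt}\big|_{t=0}\mu_{\lambda+t\alpha}$$ (for $\alpha=0$ this is $\nabla\cdot X=0$). On it, $$D\Phi(\lambda,\psi)(\alpha,X)=\tfrac{d}{dt}\big|_{t=0}\Phi(\lambda+t\alpha,\psi)+(\psi^*\mathcal L_X\lambda)^\pi .$$ The linearized projection of $\Pi(\lambda,\psi)=\lambda$ at a strict contact pair is $$d\Pi(\lambda,\psi):\ker D\Phi(\lambda,\psi)\to T_\lambda\mathfrak C_1(M),\qquad (\alpha,X)\mapsto\alpha .$$ Let $J$ be a CR almost complex structure such that $(M,\lambda,J)$ is a contact triad, with triad metric $g=d\lambda(\cdot,J\cdot)+\lambda\otimes\lambda$.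 The cokernel of $d\Pi(\lambda,\psi)$ is understood as the kernel of its $L^2$-adjoint, $$\operatorname{Coker}d\Pi(\lambda,\psi)=\Big\{\beta\in T_\lambda\mathfrak C_1(M):\int_M\langle d\Pi(\lambda,\psi)(\alpha,X),\beta\rangle_g\,d\mu_\lambda=0\ \text{ for all }(\alpha,X)\in\ker D\Phi(\lambda,\psi)\Big\}.$$ Let $(\lambda,\psi)$ be a strict contact pair with $\lambda$ non-projectible, and let $J$ be as above. Then $$\operatorname{Coker}d\Pi(\lambda,\psi)=\{0\}.$$ The same holds on Floer's $C^{(1,\varepsilon)}$ spaces for every sequence $\varepsilon$ that decays sufficiently fast. Let $\mathfrak A$ be a finite atlas of Darboux charts with coordinates $(q,p,z)$, in which $\lambda=dz-\sum_ip_i\,dq_i$, each defined on a neighbourhood of the preimage of a closed cube $[-r,r]^{2n+1}$ (where $r>0$ may depend on the chart), and such that the preimages of the open cubes cover $M$. For positive numbers $\varepsilon=(\varepsilon_k)_{k\ge0}$ call a one-form or a vector field of class $C^{(1,\varepsilon)}$ if all its components $f$ in these charts satisfy $\sum_k\varepsilon_k\|D^kf\|_{C^0}<\infty$ and $\sum_k\varepsilon_k\|D^{k+1}f\|_{C^0}<\infty$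 on the open cubes, where $\|D^kf\|_{C^0}$ is the supremum of the partial derivatives of order $k$. Then there is a positive sequence $\varepsilon^0$ such that for all $0<\varepsilon_k\le\varepsilon^0_k$ ($k\geq 0$) the only $\beta\in T_\lambda\mathfrak C_1(M)$ of class $C^{(1,\varepsilon)}$ which is $L^2$-orthogonal to $\alpha$ for all $(\alpha,X)\in\ker D\Phi(\lambda,\psi)$ of class $C^{(1,\varepsilon)}$ is $\beta=0$. -/

import Mathlib

open Set Filter Topology MeasureTheory Bundle
open scoped Manifold ContDiff ENNReal NNReal

noncomputable section

namespace StrictContact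

/-! ### Differential forms of degree one and vector fields

`M` is a manifold of dimension `2 * n + 1`, modelled on `EuclideanSpace ℝ (Fin (2 * n + 1))`. -/

/-- The model space `ℝ^(2n+1)`. -/
abbrev Model (n : ℕ) : Type := EuclideanSpace ℝ (Fin (2 * n + 1))

/-- (Not necessarily continuous) one-forms on `M`. -/
abbrev OneForm (n : ℕ) (M : Type*) [TopologicalSpace M] [ChartedSpace (Model n) M] : Type _ :=
  (x : M) → (TangentSpace (𝓡 (2 * n + 1)) x →L[ℝ] ℝ)

/-- (Not necessarily continuous) vector fields on `M`. -/
abbrev VField (n : ℕ) (M : Type*) [TopologicalSpace M] [ChartedSpace (Model n) M] : Type _ :=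
  (x : M) → TangentSpace (𝓡 (2 * n + 1)) x

/-- (Not necessarily continuous) fields of endomorphisms of the tangent spaces of `M`. -/
abbrev EndField (n : ℕ) (M : Type*) [TopologicalSpace M] [ChartedSpace (Model n) M] : Type _ :=
  (x : M) → (TangentSpace (𝓡 (2 * n + 1)) x →L[ℝ] TangentSpace (𝓡 (2 * n + 1)) x)

section Basic

variable {n : ℕ} {M : Type*} [TopologicalSpace M] [ChartedSpace (Model n) M]

/-- A smooth one-form: a smooth section of the cotangent bundle. -/
def SmoothForm [IsManifold (𝓡 (2 * n + 1)) ∞ M] (α : OneForm n M) : Prop :=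
  ContMDiff (𝓡 (2 * n + 1)) ((𝓡 (2 * n + 1)).prod 𝓘(ℝ, Model n →L[ℝ] ℝ)) ∞
    (fun x : M => TotalSpace.mk' (Model n →L[ℝ] ℝ)
      (E := fun x : M => (TangentSpace (𝓡 (2 * n + 1)) x →L[ℝ] Trivial M ℝ x)) x (α x))

/-- A smooth vector field: a smooth section of the tangent bundle. -/
def SmoothField [IsManifold (𝓡 (2 * n + 1)) ∞ M] (X : VField n M) : Prop :=
  ContMDiff (𝓡 (2 * n + 1)) (𝓡 (2 * n + 1)).tangent ∞
    (fun x : M => (⟨x, X x⟩ : TangentBundle (𝓡 (2 * n + 1)) M))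

/-- A smooth field of endomorphisms of the tangent bundle. -/
def SmoothEnd [IsManifold (𝓡 (2 * n + 1)) ∞ M] (J : EndField n M) : Prop :=
  ContMDiff (𝓡 (2 * n + 1)) ((𝓡 (2 * n + 1)).prod 𝓘(ℝ, Model n →L[ℝ] Model n)) ∞
    (fun x : M => TotalSpace.mk' (Model n →L[ℝ] Model n)
      (E := fun x : M =>
        (TangentSpace (𝓡 (2 * n + 1)) x →L[ℝ] TangentSpace (𝓡 (2 * n + 1)) x)) x (J x))

/-- The pull-back `ψ^*α` of a one-form. -/
def pullback (ψ : M → M) (α : OneForm n M) : OneForm n M := fun x =>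
  (α (ψ x)).comp (mfderiv (𝓡 (2 * n + 1)) (𝓡 (2 * n + 1)) ψ x)

/-- The one-form `α` read in the preferred chart `φ` at `x`, i.e. `(φ⁻¹)^*α`, a one-form on
the (open) image of `φ` in `ℝ^(2n+1)`. -/
def formInChart (α : OneForm n M) (x : M) (y : Model n) : Model n →L[ℝ] ℝ :=
  (α ((extChartAt (𝓡 (2 * n + 1)) x).symm y)).comp
    (mfderiv 𝓘(ℝ, Model n) (𝓡 (2 * n + 1)) (extChartAt (𝓡 (2 * n + 1)) x).symm y)

/-- The exterior derivative `dα` of a one-form. In the preferred chart at `x`,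
`dα (v, w) = D_v α (w) - D_w α (v)`; `extD α x v` is the covector `w ↦ dα (v, w)`,
i.e. the contraction `v ⌟ dα`. -/
def extD (α : OneForm n M) (x : M) (v : TangentSpace (𝓡 (2 * n + 1)) x) :
    TangentSpace (𝓡 (2 * n + 1)) x →L[ℝ] ℝ :=
  let φ := extChartAt (𝓡 (2 * n + 1)) x
  let A : Model n →L[ℝ] Model n →L[ℝ] ℝ := fderiv ℝ (formInChart α x) (φ x)
  let T : TangentSpace (𝓡 (2 * n + 1)) x →L[ℝ] Model n :=
    mfderiv (𝓡 (2 * n + 1)) 𝓘(ℝ, Model n) φ x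
  (A (T v) - A.flip (T v)).comp T

/-- The derivative `X[f]` of a function along a vector field. -/
def dirDeriv (X : VField n M) (f : M → ℝ) (x : M) : ℝ :=
  mvfderiv (𝓡 (2 * n + 1)) f x (X x)

end Basic

section Contact

variable {n : ℕ} {M : Type*} [TopologicalSpace M] [ChartedSpace (Model n) M]

/-- The top-degree form `μ_lam = lam ∧ (d lam)^n` evaluated at `2n+1` tangent vectors:
`2^{-n} ∑_σ sign σ · lam (v_{σ 0}) ∏_{i<n} d lam (v_{σ (2i+1)}, v_{σ (2i+2)})`. -/
def volForm (lam : OneForm n M) (x : M)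
    (v : Fin (2 * n + 1) → TangentSpace (𝓡 (2 * n + 1)) x) : ℝ :=
  (1 / 2 : ℝ) ^ n * ∑ σ : Equiv.Perm (Fin (2 * n + 1)), ((Equiv.Perm.sign σ : ℤ) : ℝ) *
    (lam x (v (σ 0)) *
      ∏ i : Fin n, extD lam x (v (σ ⟨2 * i.1 + 1, by omega⟩)) (v (σ ⟨2 * i.1 + 2, by omega⟩)))

/-- A contact form: a smooth one-form with `lam ∧ (d lam)^n` nowhere zero. -/
structure IsContactForm [IsManifold (𝓡 (2 * n + 1)) ∞ M] (lam : OneForm n M) : Prop where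
  smooth : SmoothForm lam
  nondegenerate : ∀ x : M, ∃ v : Fin (2 * n + 1) → TangentSpace (𝓡 (2 * n + 1)) x,
    volForm lam x v ≠ 0

open Classical in
/-- The Reeb vector field: the solution of `lam (R) = 1`, `R ⌟ d lam = 0` (unique when `lam` is a
contact form). -/
def reeb (lam : OneForm n M) : VField n M := fun x =>
  if h : ∃ R : TangentSpace (𝓡 (2 * n + 1)) x, lam x R = 1 ∧ ∀ w, extD lam x R w = 0
  then h.choose else 0

/-- The measure on the domain of the preferred chart `φ` at `c` with density
`|μ_lam (∂_1, …, ∂_{2n+1})|` with respect to Lebesgue measure in the coordinates. -/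
def chartMeasure [MeasurableSpace M] (lam : OneForm n M) (c : M) : Measure M :=
  let φ := extChartAt (𝓡 (2 * n + 1)) c
  Measure.map φ.symm
    (((volume : Measure (Model n)).restrict φ.target).withDensity fun y =>
      ENNReal.ofReal |volForm lam (φ.symm y) fun i =>
        mfderiv 𝓘(ℝ, Model n) (𝓡 (2 * n + 1)) φ.symm y (EuclideanSpace.single i (1 : ℝ))|)

/-- The measure `μ_lam` on `M` induced by the volume form `lam ∧ (d lam)^n`. The local measures
`chartMeasure lam c` agree on overlaps of chart domains; the supremum of all of them is the
measure which restricts to `chartMeasure lam c` on every chart domain. -/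
def contactMeasure [MeasurableSpace M] (lam : OneForm n M) : Measure M :=
  ⨆ c : M, chartMeasure lam c

/-- The set `𝔠_1(M)` of contact forms of volume one. -/
def ContactForms₁ [IsManifold (𝓡 (2 * n + 1)) ∞ M] [MeasurableSpace M] : Set (OneForm n M) :=
  {lam | IsContactForm lam ∧ contactMeasure lam univ = 1}

/-- Non-projectible contact forms: the only smooth function of mean zero which is invariant
under the Reeb flow is `0`. -/
def NonProjectible [MeasurableSpace M] (lam : OneForm n M) : Prop :=
  {H : M → ℝ | ContMDiff (𝓡 (2 * n + 1)) 𝓘(ℝ, ℝ) ∞ H ∧ (∀ x, dirDeriv (reeb lam) H x = 0) ∧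
    ∫ x, H x ∂(contactMeasure lam) = 0} = {0}

/-- Strict contact pairs `(lam, ψ)`, with `lam` of volume one. -/
def StrictContactPairs [IsManifold (𝓡 (2 * n + 1)) ∞ M] [MeasurableSpace M] :
    Set (OneForm n M × (M ≃ₘ^∞⟮𝓡 (2 * n + 1), 𝓡 (2 * n + 1)⟯ M)) :=
  {p | p.1 ∈ ContactForms₁ ∧ pullback p.2 p.1 = p.1}

/-! ### The linearization -/

/-- The tangent space `T_lam 𝔠_1(M)`: smooth one-forms `α` with `∫ α (R_lam) dμ_lam = 0`. -/
def TangentForms [IsManifold (𝓡 (2 * n + 1)) ∞ M] [MeasurableSpace M] (lam : OneForm n M) :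
    Set (OneForm n M) :=
  {α | SmoothForm α ∧ ∫ x, α x (reeb lam x) ∂(contactMeasure lam) = 0}

/-- The Lie derivative `L_X α = d (α (X)) + X ⌟ dα` of a one-form. -/
def lieForm (X : VField n M) (α : OneForm n M) : OneForm n M := fun x =>
  mvfderiv (𝓡 (2 * n + 1)) (fun y => α y (X y)) x + extD α x (X x)

/-- The first variation `δ_α μ_lam` of the volume form `μ_lam = lam ∧ (d lam)^n` in the direction of
a one-form `α`, a top-degree form. -/
def volVariation (lam α : OneForm n M) (x : M)
    (v : Fin (2 * n + 1) → TangentSpace (𝓡 (2 * n + 1)) x) : ℝ :=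
  deriv (fun t : ℝ => volForm (lam + t • α) x v) 0

/-- The Lie derivative `L_X μ_lam` of the volume form `μ_lam = lam ∧ (d lam)^n`. Lie derivatives
commute with `d` and are derivations of the wedge product, so it is the first variation of `μ_lam`
in the direction `L_X lam`. It equals `(∇·X) μ_lam`. -/
def volLie (X : VField n M) (lam : OneForm n M) (x : M)
    (v : Fin (2 * n + 1) → TangentSpace (𝓡 (2 * n + 1)) x) : ℝ :=
  volVariation lam (lieForm X lam) x v

/-- The projection `θ^π = θ - θ (R_lam) lam` of one-forms onto the annihilator of the Reeb field,
along the multiples of `lam`. -/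
def proj (lam θ : OneForm n M) : OneForm n M := fun x => θ x - θ x (reeb lam x) • lam x

/-- The map `Φ (lam, ψ) = (ψ^*lam)^π`. -/
def Phi (lam : OneForm n M) (ψ : M → M) : OneForm n M := proj lam (pullback ψ lam)

/-- The linearization `DΦ (lam, ψ) (α, X)`, a one-form, at `x` on `v`. Here `X` is a vector field on
`M`, which stands for the variation `X ∘ ψ` of `ψ`. The first summand is the derivative of `Φ` in
the direction `α`, the second one, `(ψ^* L_X lam)^π`, the derivative in the direction of `X ∘ ψ`. -/
def dPhi (lam : OneForm n M) (ψ : M → M) (α : OneForm n M) (X : VField n M) (x : M)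
    (v : TangentSpace (𝓡 (2 * n + 1)) x) : ℝ :=
  deriv (fun t : ℝ => Phi (lam + t • α) ψ x v) 0 + proj lam (pullback ψ (lieForm X lam)) x v

/-- The tangent space at `(lam, ψ)` of `𝔇𝔦𝔣𝔣_1(M, μ)`, the space of pairs of a contact form `lam` of
volume one and a diffeomorphism `ψ` with `ψ^*μ_lam = μ_lam`: the pairs `(α, X)` with
`α ∈ T_lam 𝔠_1(M)` and `X` smooth which satisfy the linearization
`ψ^*(δ_α μ_lam + L_X μ_lam) = δ_α μ_lam` of the equation `ψ^*μ_lam = μ_lam`.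
In the fibre direction, `α = 0`, it says `∇·X = 0`. -/
def TangentDiff [IsManifold (𝓡 (2 * n + 1)) ∞ M] [MeasurableSpace M] (lam : OneForm n M)
    (ψ : M → M) : Set (OneForm n M × VField n M) :=
  {p | p.1 ∈ TangentForms lam ∧ SmoothField p.2 ∧
    ∀ (x : M) (v : Fin (2 * n + 1) → TangentSpace (𝓡 (2 * n + 1)) x),
      volVariation lam p.1 (ψ x)
          (fun i => mfderiv (𝓡 (2 * n + 1)) (𝓡 (2 * n + 1)) ψ x (v i)) +
        volLie p.2 lam (ψ x)
          (fun i => mfderiv (𝓡 (2 * n + 1)) (𝓡 (2 * n + 1)) ψ x (v i)) =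
      volVariation lam p.1 x v}

/-- The tangent space of the space of strict contact pairs `Φ⁻¹(0) ⊆ 𝔇𝔦𝔣𝔣_1(M, μ)` at `(lam, ψ)`:
the kernel of `DΦ (lam, ψ)`. -/
def TangentStrict [IsManifold (𝓡 (2 * n + 1)) ∞ M] [MeasurableSpace M] (lam : OneForm n M)
    (ψ : M → M) : Set (OneForm n M × VField n M) :=
  {p | p ∈ TangentDiff lam ψ ∧ ∀ x v, dPhi lam ψ p.1 p.2 x v = 0}

/-- The derivative `dΠ (lam, ψ) (α, X) = α` of the projection `Π (lam, ψ) = lam`. -/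
def dPi (p : OneForm n M × VField n M) : OneForm n M := p.1

/-! ### The `L²`-pairing and the cokernel -/

/-- A CR almost complex structure adapted to `lam`, so that `(M, lam, J)` is a contact triad:
`J` vanishes on the Reeb field, preserves `ξ = ker lam`, satisfies `J² = -1` on `ξ`, and
`d lam (·, J ·)` is a symmetric positive definite form on `ξ`. -/
structure IsContactTriad [IsManifold (𝓡 (2 * n + 1)) ∞ M] (lam : OneForm n M) (J : EndField n M) :
    Prop where
  smooth : SmoothEnd J
  reeb : ∀ x, J x (reeb lam x) = 0
  horizontal : ∀ x v, lam x (J x v) = 0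
  sq : ∀ x v, lam x v = 0 → J x (J x v) = -v
  symm : ∀ x v w, lam x v = 0 → lam x w = 0 → extD lam x v (J x w) = extD lam x w (J x v)
  pos : ∀ x v, lam x v = 0 → v ≠ 0 → 0 < extD lam x v (J x v)

/-- The triad metric `g = d lam (·, J ·) + lam ⊗ lam`. -/
def triadMetric (lam : OneForm n M) (J : EndField n M) (x : M)
    (v w : TangentSpace (𝓡 (2 * n + 1)) x) : ℝ :=
  extD lam x v (J x w) + lam x v * lam x w

open Classical in
/-- The vector field `β^♯` with `g (β^♯, ·) = β`. -/
def sharp (lam : OneForm n M) (J : EndField n M) (β : OneForm n M) : VField n M := fun x =>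
  if h : ∃ Y : TangentSpace (𝓡 (2 * n + 1)) x, ∀ w, triadMetric lam J x Y w = β x w
  then h.choose else 0

/-- The `L²`-pairing `∫ ⟨α, β⟩ dμ_lam` of one-forms with respect to the triad metric;
`⟨α, β⟩ = α (β^♯)`. -/
def l2Pairing [MeasurableSpace M] (lam : OneForm n M) (J : EndField n M) (α β : OneForm n M) : ℝ :=
  ∫ x, α x (sharp lam J β x) ∂(contactMeasure lam)

/-- The cokernel of `dΠ (lam, ψ) : T_{(lam, ψ)} 𝔠𝔬𝔫𝔱_1^st(M) → T_lam 𝔠_1(M)`, as the kernel of its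
`L²`-adjoint: all `β ∈ T_lam 𝔠_1(M)` which are `L²`-orthogonal to the image of `dΠ (lam, ψ)`. -/
def cokerDPi [IsManifold (𝓡 (2 * n + 1)) ∞ M] [MeasurableSpace M] (lam : OneForm n M) (ψ : M → M)
    (J : EndField n M) : Set (OneForm n M) :=
  {β | β ∈ TangentForms lam ∧ ∀ p ∈ TangentStrict lam ψ, l2Pairing lam J (dPi p) β = 0}

end Contact

/-! ### Floer's `C^ε` spaces -/

section Floer

variable {n : ℕ} {M : Type*} [TopologicalSpace M] [ChartedSpace (Model n) M]

/-- The open cube `(-r, r)^(2n+1)`. -/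
def openCube (n : ℕ) (r : ℝ) : Set (Model n) := {y | ∀ i, |y i| < r}

/-- The closed cube `[-r, r]^(2n+1)`. -/
def closedCube (n : ℕ) (r : ℝ) : Set (Model n) := {y | ∀ i, |y i| ≤ r}

/-- The components of the one-form `α` in the coordinates of a chart `e`. -/
def formCoord (e : OpenPartialHomeomorph M (Model n)) (α : OneForm n M) (i : Fin (2 * n + 1))
    (y : Model n) : ℝ :=
  α (e.symm y) (mfderiv (𝓡 (2 * n + 1)) (𝓡 (2 * n + 1)) e.symm y
    (EuclideanSpace.single i (1 : ℝ) : Model n))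

/-- The components of the vector field `X` in the coordinates of a chart `e`. -/
def fieldCoord (e : OpenPartialHomeomorph M (Model n)) (X : VField n M) (i : Fin (2 * n + 1))
    (y : Model n) : ℝ :=
  (show Model n from mfderiv (𝓡 (2 * n + 1)) (𝓡 (2 * n + 1)) e (e.symm y) (X (e.symm y))) i

/-- A finite atlas of Darboux charts of `M`: smooth charts `e_a` with coordinates
`(q_1, …, q_n, p_1, …, p_n, z)`, defined on a neighbourhood of the preimage of a closed cube,
in which `lam = dz - ∑ p_i dq_i`, and such that the preimages of the open cubes cover `M`. -/
structure DarbouxAtlas [IsManifold (𝓡 (2 * n + 1)) ∞ M] (lam : OneForm n M) where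
  N : ℕ
  chart : Fin N → OpenPartialHomeomorph M (Model n)
  radius : Fin N → ℝ
  smooth : ∀ a, chart a ∈ IsManifold.maximalAtlas (𝓡 (2 * n + 1)) ∞ M
  radius_pos : ∀ a, 0 < radius a
  cube_subset : ∀ a, closedCube n (radius a) ⊆ (chart a).target
  darboux_q : ∀ a, ∀ y ∈ closedCube n (radius a), ∀ i : Fin n,
    formCoord (chart a) lam ⟨i.1, by omega⟩ y = -(y ⟨n + i.1, by omega⟩)
  darboux_p : ∀ a, ∀ y ∈ closedCube n (radius a), ∀ i : Fin n,
    formCoord (chart a) lam ⟨n + i.1, by omega⟩ y = 0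
  darboux_z : ∀ a, ∀ y ∈ closedCube n (radius a),
    formCoord (chart a) lam (Fin.last (2 * n)) y = 1
  cover : ∀ x : M, ∃ a, x ∈ (chart a).source ∧ chart a x ∈ openCube n (radius a)

/-- The norm `‖D^k f‖_{C^0}` on the cube `(-r, r)^(2n+1)`: the supremum of all partial derivatives
of order `k` (possibly infinite). -/
def derivNorm (r : ℝ) (k : ℕ) (f : Model n → ℝ) : ℝ≥0∞ :=
  ⨆ y ∈ openCube n r, ⨆ I : Fin k → Fin (2 * n + 1),
    ‖iteratedFDeriv ℝ k f y (fun j => EuclideanSpace.single (I j) (1 : ℝ))‖ₑ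

/-- `f` is of class `C^(1,ε)` on the cube: `∑ ε_k ‖D^k f‖ < ∞` and `∑ ε_k ‖D^k (D f)‖ < ∞`. -/
def IsC1Eps (ε : ℕ → ℝ≥0) (r : ℝ) (f : Model n → ℝ) : Prop :=
  ∑' k, (ε k : ℝ≥0∞) * derivNorm r k f < ⊤ ∧ ∑' k, (ε k : ℝ≥0∞) * derivNorm r (k + 1) f < ⊤

/-- One-forms of class `C^(1,ε)`: all components in all charts of the atlas are. -/
def C1EpsForms [IsManifold (𝓡 (2 * n + 1)) ∞ M] {lam : OneForm n M} (𝔄 : DarbouxAtlas lam)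
    (ε : ℕ → ℝ≥0) : Set (OneForm n M) :=
  {α | ∀ a i, IsC1Eps ε (𝔄.radius a) (formCoord (𝔄.chart a) α i)}

/-- Vector fields of class `C^(1,ε)`: all components in all charts of the atlas are. -/
def C1EpsFields [IsManifold (𝓡 (2 * n + 1)) ∞ M] {lam : OneForm n M} (𝔄 : DarbouxAtlas lam)
    (ε : ℕ → ℝ≥0) : Set (VField n M) :=
  {X | ∀ a i, IsC1Eps ε (𝔄.radius a) (fieldCoord (𝔄.chart a) X i)}

/-- The cokernel of `dΠ (lam, ψ)` between the `C^(1,ε)` tangent spaces, as the kernel of its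
`L²`-adjoint: all `β ∈ T_lam 𝔠_1^(1,ε)(M)` which are `L²`-orthogonal to the `α` of all
`(α, X) ∈ ker DΦ (lam, ψ)` of class `C^(1,ε)`. -/
def cokerDPiEps [IsManifold (𝓡 (2 * n + 1)) ∞ M] [MeasurableSpace M] {lam : OneForm n M}
    (𝔄 : DarbouxAtlas lam) (ε : ℕ → ℝ≥0) (ψ : M → M) (J : EndField n M) : Set (OneForm n M) :=
  {β | β ∈ TangentForms lam ∧ β ∈ C1EpsForms 𝔄 ε ∧
    ∀ p ∈ TangentStrict lam ψ, p.1 ∈ C1EpsForms 𝔄 ε → p.2 ∈ C1EpsFields 𝔄 ε →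
      l2Pairing lam J (dPi p) β = 0}

end Floer

end StrictContact

end

open Set Filter Topology MeasureTheory Bundle
open scoped Manifold ContDiff ENNReal NNReal

noncomputable section

namespace StrictContact

/-! Write R for the Reeb field. The image of dΠ contains every mean-zero α for which the
cohomological equation α(R)∘ψ⁻¹ − α(R) = R[H] has a smooth solution H. Indeed, put θ = (ψ⁻¹)^*α − α.
Since ψ preserves R, the form θ − dH vanishes on R, so there is a smooth X with λ(X) = H and X ⌟ dλ
= θ − dH, and Cartan's formula gives L_X λ = θ, that is, ψ^*(α + L_X λ) = α. This one identity
implies both the linearized volume equation and DΦ(α, X) = 0, because DΦ(α, X) = (ψ^*(α + L_X λ) −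
α)^π at a strict pair (`IsContactForm.exists_mem_tangentStrict`, `IsContactForm.mem_tangentStrict`).

Two test forms then annihilate a cokernel element β. The form β^π vanishes on R, so H = 0 works, and
∫⟨β^π, β⟩ = ∫|β^π|² = 0 forces β = bλ with b = β(R). Now let K = R[b] and α = R[K]λ: here H = K∘ψ⁻¹
− K works, and orthogonality says ∫ b R[K] = 0. Derivatives along R integrate to zero, so expanding
∫ R[Kb] leaves ∫ K² = 0. Hence R[b] = K = 0, and non-projectibility kills b, which has mean zero
(`IsContactTriad.eq_zero_of_orthogonal`).

The vanishing of ∫ R[f] dμ_λ is Stokes' theorem for R[f] λ ∧ (dλ)^n = df ∧ (dλ)^n = d(f (dλ)^n). It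
is proved by integration by parts in charts and globalized by a partition of unity
(`IsContactForm.integral_dirDeriv_reeb`).

The Floer version reduces to the smooth one. The test pairs depend on β, so no single ε visibly
serves them all. But smooth one-forms are continuous functions on TM, the space C(TM, ℝ) is second
countable, and pairing with a fixed smooth β is continuous. Countably many tangent pairs therefore
already detect orthogonality (`IsContactTriad.exists_seq_orthogonal`), and a diagonal choice of ε⁰
puts all of them into the C^(1,ε) class (`DarbouxAtlas.exists_eps`). -/

/-! ### Linear algebra of `a ∧ A^n` -/

section LinearAlgebra

variable {V : Type*} [AddCommGroup V] [Module ℝ V] {n : ℕ}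

/-- `a ∧ A^n` evaluated at `2n+1` vectors. -/
def topForm (a : V →ₗ[ℝ] ℝ) (A : V →ₗ[ℝ] V →ₗ[ℝ] ℝ) (v : Fin (2 * n + 1) → V) : ℝ :=
  (1 / 2 : ℝ) ^ n * ∑ σ : Equiv.Perm (Fin (2 * n + 1)), ((Equiv.Perm.sign σ : ℤ) : ℝ) *
    (a (v (σ 0)) *
      ∏ i : Fin n, A (v (σ ⟨2 * i.1 + 1, by omega⟩)) (v (σ ⟨2 * i.1 + 2, by omega⟩)))

/-- Slot 0 belongs to the factor `a`, slots 2i+1 and 2i+2 to the i-th factor `A`. -/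
theorem fin_eq_zero_or_pair (j : Fin (2 * n + 1)) :
    j = 0 ∨ (∃ i : Fin n, j = ⟨2 * i.1 + 1, by omega⟩) ∨ ∃ i : Fin n, j = ⟨2 * i.1 + 2, by omega⟩ := by
  obtain ⟨j, hj⟩ := j
  rcases Nat.eq_zero_or_pos j with h | h
  · left; exact Fin.ext h
  · right
    rcases Nat.even_or_odd' j with ⟨k, hk | hk⟩
    · right; exact ⟨⟨k - 1, by omega⟩, Fin.ext (by simp; omega)⟩
    · left; exact ⟨⟨k, by omega⟩, Fin.ext (by simp; omega)⟩

/-- Each slot enters exactly one factor, which is linear in it, and the other factors are constants.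
This gives both multilinearity fields of `prodForm`. -/
theorem exists_linear_update (a : V →ₗ[ℝ] ℝ) (A : V →ₗ[ℝ] V →ₗ[ℝ] ℝ) (v : Fin (2 * n + 1) → V)
    (j : Fin (2 * n + 1)) : ∃ l : V →ₗ[ℝ] ℝ, ∀ x, a (Function.update v j x 0) *
      ∏ i : Fin n, A (Function.update v j x ⟨2 * i.1 + 1, by omega⟩)
        (Function.update v j x ⟨2 * i.1 + 2, by omega⟩) = l x := by
  rcases fin_eq_zero_or_pair j with rfl | ⟨k, rfl⟩ | ⟨k, rfl⟩
  · refine ⟨(∏ i : Fin n, A (v ⟨2 * i.1 + 1, by omega⟩) (v ⟨2 * i.1 + 2, by omega⟩)) • a,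
      fun x => ?_⟩
    simp [mul_comm]
  · refine ⟨(a (v 0) * ∏ i ∈ Finset.univ.erase k, A (v ⟨2 * i.1 + 1, by omega⟩)
      (v ⟨2 * i.1 + 2, by omega⟩)) • (A.flip (v ⟨2 * k.1 + 2, by omega⟩)), fun x => ?_⟩
    rw [← Finset.mul_prod_erase _ _ (Finset.mem_univ k), Function.update_self,
      Function.update_of_ne (by simp [Fin.ext_iff]), Function.update_of_ne (by simp [Fin.ext_iff]),
      Finset.prod_congr rfl fun i hi => by
        have : i.1 ≠ k.1 := fun h => Finset.ne_of_mem_erase hi (Fin.ext h)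
        rw [Function.update_of_ne (by simp [Fin.ext_iff]; omega),
          Function.update_of_ne (by simp [Fin.ext_iff]; omega)]]
    simp only [LinearMap.smul_apply, LinearMap.flip_apply, smul_eq_mul]
    ring
  · refine ⟨(a (v 0) * ∏ i ∈ Finset.univ.erase k, A (v ⟨2 * i.1 + 1, by omega⟩)
      (v ⟨2 * i.1 + 2, by omega⟩)) • (A (v ⟨2 * k.1 + 1, by omega⟩)), fun x => ?_⟩
    rw [← Finset.mul_prod_erase _ _ (Finset.mem_univ k), Function.update_self,
      Function.update_of_ne (by simp [Fin.ext_iff]), Function.update_of_ne (by simp [Fin.ext_iff]),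
      Finset.prod_congr rfl fun i hi => by
        have : i.1 ≠ k.1 := fun h => Finset.ne_of_mem_erase hi (Fin.ext h)
        rw [Function.update_of_ne (by simp [Fin.ext_iff]; omega),
          Function.update_of_ne (by simp [Fin.ext_iff]; omega)]]
    simp only [LinearMap.smul_apply, smul_eq_mul]
    ring

/-- The multilinear map `v ↦ a (v₀) A (v₁, v₂) ⋯ A (v₂ₙ₋₁, v₂ₙ)`. -/
def prodForm (a : V →ₗ[ℝ] ℝ) (A : V →ₗ[ℝ] V →ₗ[ℝ] ℝ) :
    MultilinearMap ℝ (fun _ : Fin (2 * n + 1) => V) ℝ where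
  toFun v := a (v 0) * ∏ i : Fin n, A (v ⟨2 * i.1 + 1, by omega⟩) (v ⟨2 * i.1 + 2, by omega⟩)
  map_update_add' {inst} v j x y := by
    obtain rfl : inst = instDecidableEqFin (2 * n + 1) := Subsingleton.elim _ _
    obtain ⟨l, hl⟩ := exists_linear_update a A v j
    simp only [hl, map_add]
  map_update_smul' {inst} v j c x := by
    obtain rfl : inst = instDecidableEqFin (2 * n + 1) := Subsingleton.elim _ _
    obtain ⟨l, hl⟩ := exists_linear_update a A v j
    simp only [hl, map_smul]

/-- `a ∧ A^n` as an alternating map. -/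
def topAlt (a : V →ₗ[ℝ] ℝ) (A : V →ₗ[ℝ] V →ₗ[ℝ] ℝ) : V [⋀^Fin (2 * n + 1)]→ₗ[ℝ] ℝ :=
  (1 / 2 : ℝ) ^ n • MultilinearMap.alternatization (prodForm a A)

theorem topAlt_apply (a : V →ₗ[ℝ] ℝ) (A : V →ₗ[ℝ] V →ₗ[ℝ] ℝ) (v : Fin (2 * n + 1) → V) :
    topAlt a A v = topForm a A v := by
  simp [topAlt, topForm, MultilinearMap.alternatization_apply, prodForm, Units.smul_def]

/-- Alternating forms of top degree are a line, spanned by the determinant of a basis. -/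
theorem topForm_eq_det_mul (a : V →ₗ[ℝ] ℝ) (A : V →ₗ[ℝ] V →ₗ[ℝ] ℝ)
    (b : Module.Basis (Fin (2 * n + 1)) ℝ V) (v : Fin (2 * n + 1) → V) :
    topForm a A v = b.det v * topForm a A b := by
  rw [← topAlt_apply, ← topAlt_apply]
  conv_lhs => rw [AlternatingMap.eq_smul_basis_det b (topAlt a A)]
  simp [mul_comm]

theorem topForm_map (a : V →ₗ[ℝ] ℝ) (A : V →ₗ[ℝ] V →ₗ[ℝ] ℝ)
    (b : Module.Basis (Fin (2 * n + 1)) ℝ V) (T : V →ₗ[ℝ] V) :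
    topForm a A (fun i => T (b i)) = LinearMap.det T * topForm a A b := by
  rw [topForm_eq_det_mul a A b]
  congr 1
  have := b.det_comp T b
  rw [b.det_self, mul_one] at this
  exact this

/-- Complete `r` to a basis. On that basis every term of the sum has `r` in some slot, and the
factor owning that slot vanishes. -/
theorem topForm_eq_zero_of_mem_ker (a : V →ₗ[ℝ] ℝ) (A : V →ₗ[ℝ] V →ₗ[ℝ] ℝ)
    (hA : ∀ v w, A v w = -A w v) (hV : Module.finrank ℝ V = 2 * n + 1) {r : V} (hr : r ≠ 0)
    (har : a r = 0) (hAr : ∀ w, A r w = 0) (v : Fin (2 * n + 1) → V) : topForm a A v = 0 := by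
  have hfd : FiniteDimensional ℝ V := Module.finite_of_finrank_pos (by omega)
  obtain ⟨b, j, hb⟩ : ∃ (b : Module.Basis (Fin (2 * n + 1)) ℝ V) (j : _), b j = r := by
    have hli : LinearIndepOn ℝ id ({r} : Set V) := LinearIndepOn.singleton hr
    let B := Module.Basis.extend hli
    have hrm : r ∈ hli.extend (Set.subset_univ _) := hli.subset_extend _ rfl
    have : Fintype (hli.extend (Set.subset_univ {r})) := FiniteDimensional.fintypeBasisIndex B
    let e : hli.extend (Set.subset_univ {r}) ≃ Fin (2 * n + 1) :=
      Fintype.equivFinOfCardEq (by rw [← hV, Module.finrank_eq_card_basis B])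
    refine ⟨B.reindex e, e ⟨r, hrm⟩, ?_⟩
    simp [B]
  rw [topForm_eq_det_mul a A b, topForm]
  refine mul_eq_zero_of_right _ (mul_eq_zero_of_right _ (Finset.sum_eq_zero fun σ _ => ?_))
  refine mul_eq_zero_of_right _ ?_
  rcases fin_eq_zero_or_pair (σ.symm j) with h | ⟨k, h⟩ | ⟨k, h⟩
  · rw [← h]; simp [hb, har]
  · refine mul_eq_zero_of_right _ (Finset.prod_eq_zero (Finset.mem_univ k) ?_)
    rw [← h]; simp [hb, hAr]
  · refine mul_eq_zero_of_right _ (Finset.prod_eq_zero (Finset.mem_univ k) ?_)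
    rw [← h, hA]; simp [hb, hAr]

/-- A skew matrix of odd size is singular: det G = det Gᵀ = det (−G) = −det G. -/
theorem exists_ker_of_skew_odd (A : V →ₗ[ℝ] V →ₗ[ℝ] ℝ)
    (hA : ∀ v w, A v w = -A w v) (hV : Module.finrank ℝ V = 2 * n + 1) :
    ∃ r : V, r ≠ 0 ∧ ∀ w, A r w = 0 := by
  have hfd : FiniteDimensional ℝ V := Module.finite_of_finrank_pos (by omega)
  let b : Module.Basis (Fin (2 * n + 1)) ℝ V := Module.finBasisOfFinrankEq ℝ V hV
  let G : Matrix (Fin (2 * n + 1)) (Fin (2 * n + 1)) ℝ := Matrix.of fun i j => A (b j) (b i)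
  have hG : G.transpose = -G := by
    ext i j; simp [G, hA (b i) (b j)]
  have hdet : G.det = 0 := by
    have h1 := G.det_transpose
    rw [hG, Matrix.det_neg] at h1
    simp [pow_succ, pow_mul] at h1
    linarith
  obtain ⟨c, hc, hc'⟩ := Matrix.exists_mulVec_eq_zero_iff.2 hdet
  refine ⟨∑ i, c i • b i, fun h => hc ?_, fun w => ?_⟩
  · ext i
    have := Fintype.linearIndependent_iff.1 b.linearIndependent c h i
    simpa using this
  · have : A (∑ i, c i • b i) = 0 := by
      refine b.ext fun j => ?_
      have := congrFun hc' j
      simp only [Matrix.mulVec, dotProduct, G, Matrix.of_apply, Pi.zero_apply] at this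
      simp only [map_sum, map_smul, LinearMap.sum_apply, LinearMap.smul_apply, smul_eq_mul,
        LinearMap.zero_apply]
      rw [← this]
      exact Finset.sum_congr rfl fun i _ => mul_comm _ _
    rw [this]; rfl

theorem eq_zero_of_topForm_ne_zero {a : V →ₗ[ℝ] ℝ} {A : V →ₗ[ℝ] V →ₗ[ℝ] ℝ}
    (hA : ∀ v w, A v w = -A w v) (hV : Module.finrank ℝ V = 2 * n + 1)
    {v : Fin (2 * n + 1) → V} (hv : topForm a A v ≠ 0) {r : V}
    (har : a r = 0) (hAr : ∀ w, A r w = 0) : r = 0 := by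
  by_contra hr
  exact hv (topForm_eq_zero_of_mem_ker a A hA hV hr har hAr v)

theorem exists_reeb_vector {a : V →ₗ[ℝ] ℝ} {A : V →ₗ[ℝ] V →ₗ[ℝ] ℝ}
    (hA : ∀ v w, A v w = -A w v) (hV : Module.finrank ℝ V = 2 * n + 1)
    {v : Fin (2 * n + 1) → V} (hv : topForm a A v ≠ 0) :
    ∃ r : V, a r = 1 ∧ ∀ w, A r w = 0 := by
  obtain ⟨r, hr, hAr⟩ := exists_ker_of_skew_odd A hA hV
  have har : a r ≠ 0 := fun h => hr (eq_zero_of_topForm_ne_zero hA hV hv h hAr)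
  refine ⟨(a r)⁻¹ • r, by simp [har], fun w => by simp [hAr]⟩

/-- The covector a − a(r) l kills r, as does A, so its wedge with A^n is zero. With a = df, l = λ
and r = R this is df ∧ (dλ)^n = R[f] λ ∧ (dλ)^n. -/
theorem topForm_eq_apply_mul {a l : V →ₗ[ℝ] ℝ} {A : V →ₗ[ℝ] V →ₗ[ℝ] ℝ}
    (hA : ∀ v w, A v w = -A w v) (hV : Module.finrank ℝ V = 2 * n + 1) {r : V} (hl : l r = 1)
    (hAr : ∀ w, A r w = 0) (v : Fin (2 * n + 1) → V) :
    topForm a A v = a r * topForm l A v := by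
  have hr : r ≠ 0 := by rintro rfl; simp at hl
  have h := topForm_eq_zero_of_mem_ker (a - a r • l) A hA hV hr (by simp [hl]) hAr v
  rw [topForm] at h ⊢
  rw [topForm, ← sub_eq_zero, ← h, mul_left_comm, ← mul_sub, Finset.mul_sum,
    ← Finset.sum_sub_distrib]
  congr 1
  refine Finset.sum_congr rfl fun σ _ => ?_
  simp only [LinearMap.sub_apply, LinearMap.smul_apply, smul_eq_mul]
  ring

end LinearAlgebra

/-! ### The divergence theorem for `df ∧ (dθ)^n` in the model space -/

section Model

variable {n : ℕ}

/-- The standard basis of the model space. -/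
def stdBasis (n : ℕ) : Module.Basis (Fin (2 * n + 1)) ℝ (Model n) :=
  (EuclideanSpace.basisFun (Fin (2 * n + 1)) ℝ).toBasis

theorem stdBasis_apply (i : Fin (2 * n + 1)) :
    stdBasis n i = EuclideanSpace.single i (1 : ℝ) := by
  simp [stdBasis]

/-- A continuous bilinear form as an algebraic one. -/
def toBilin {V : Type*} [NormedAddCommGroup V] [NormedSpace ℝ V] (A : V →L[ℝ] V →L[ℝ] ℝ) :
    V →ₗ[ℝ] V →ₗ[ℝ] ℝ :=
  (ContinuousLinearMap.coeLM ℝ).comp A.toLinearMap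

@[simp] theorem toBilin_apply {V : Type*} [NormedAddCommGroup V] [NormedSpace ℝ V]
    (A : V →L[ℝ] V →L[ℝ] ℝ) (v w : V) : toBilin A v w = A v w := rfl

/-- The exterior derivative `dθ (v, w) = D_v θ (w) - D_w θ (v)` of a one-form on the model space. -/
def curl (θ : Model n → Model n →L[ℝ] ℝ) (y : Model n) : Model n →L[ℝ] Model n →L[ℝ] ℝ :=
  fderiv ℝ θ y - (fderiv ℝ θ y).flip

theorem curl_apply (θ : Model n → Model n →L[ℝ] ℝ) (y v w : Model n) :
    curl θ y v w = fderiv ℝ θ y v w - fderiv ℝ θ y w v := rfl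

theorem curl_skew (θ : Model n → Model n →L[ℝ] ℝ) (y v w : Model n) :
    curl θ y v w = -curl θ y w v := by
  simp [curl_apply]

theorem contDiffOn_curl {θ : Model n → Model n →L[ℝ] ℝ} {U : Set (Model n)} (hU : IsOpen U)
    (hθ : ContDiffOn ℝ ∞ θ U) : ContDiffOn ℝ ∞ (curl θ) U := by
  have h : ContDiffOn ℝ ∞ (fderiv ℝ θ) U := hθ.fderiv_of_isOpen hU (by simp)
  refine contDiffOn_clm_apply.2 fun v => contDiffOn_clm_apply.2 fun w => ?_
  exact ((h.clm_apply contDiffOn_const).clm_apply contDiffOn_const).sub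
    ((h.clm_apply contDiffOn_const).clm_apply contDiffOn_const)

/-- The second derivative of `g` is symmetric and cancels in the antisymmetrization. -/
theorem curl_pullback {θ : Model n → Model n →L[ℝ] ℝ} {g : Model n → Model n} {y : Model n}
    (hg : ContDiffAt ℝ ∞ g y) (hθ : DifferentiableAt ℝ θ (g y)) (v w : Model n) :
    curl (fun z => (θ (g z)).comp (fderiv ℝ g z)) y v w =
      curl θ (g y) (fderiv ℝ g y v) (fderiv ℝ g y w) := by
  have hgd : DifferentiableAt ℝ g y := hg.differentiableAt (by simp)
  have hg' : DifferentiableAt ℝ (fderiv ℝ g) y :=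
    (hg.fderiv_right (m := 1) (by norm_cast)).differentiableAt (by simp)
  have hd : HasFDerivAt (fun z => θ (g z)) ((fderiv ℝ θ (g y)).comp (fderiv ℝ g y)) y :=
    hθ.hasFDerivAt.comp y hgd.hasFDerivAt
  have h := hd.clm_comp hg'.hasFDerivAt
  have hs : IsSymmSndFDerivAt ℝ g y := hg.isSymmSndFDerivAt
    (by simpa using WithTop.coe_le_coe.2 (le_top (a := (2 : ℕ∞))))
  rw [curl_apply, curl_apply, h.fderiv]
  simp [hs v w]

theorem curl_congr {θ η : Model n → Model n →L[ℝ] ℝ} {y : Model n} (h : θ =ᶠ[𝓝 y] η) :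
    curl θ y = curl η y := by
  rw [curl, curl, h.fderiv_eq]

/-- Right multiplication by the transposition flips every sign and preserves `F`, so the sum equals
its own negative. -/
theorem sum_sign_eq_zero {N : ℕ} (F : Equiv.Perm (Fin N) → ℝ) {a b : Fin N} (hab : a ≠ b)
    (hF : ∀ σ, F (σ * Equiv.swap a b) = F σ) :
    ∑ σ, ((Equiv.Perm.sign σ : ℤ) : ℝ) * F σ = 0 := by
  have h := Equiv.sum_comp (Equiv.mulRight (Equiv.swap a b))
    (fun σ => ((Equiv.Perm.sign σ : ℤ) : ℝ) * F σ)
  simp only [Equiv.coe_mulRight, hF, Equiv.Perm.sign_mul, Equiv.Perm.sign_swap hab, mul_neg,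
    mul_one, Units.val_neg, Int.cast_neg, neg_mul, Finset.sum_neg_distrib] at h
  linarith

/-- The coefficients of `(dθ)^n` are divergence free: `d ((dθ)^n) = 0`. -/
theorem sum_sign_fderiv_prod_curl_eq_zero {θ : Model n → Model n →L[ℝ] ℝ} {y : Model n}
    (hθ : ContDiffAt ℝ ∞ θ y) (e : Fin (2 * n + 1) → Model n) :
    ∑ σ : Equiv.Perm (Fin (2 * n + 1)), ((Equiv.Perm.sign σ : ℤ) : ℝ) *
      fderiv ℝ (fun z => ∏ i : Fin n, curl θ z (e (σ ⟨2 * i.1 + 1, by omega⟩))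
        (e (σ ⟨2 * i.1 + 2, by omega⟩))) y (e (σ 0)) = 0 := by
  have hd : DifferentiableAt ℝ (fderiv ℝ θ) y :=
    (hθ.fderiv_right (m := 1) (by norm_cast)).differentiableAt (by simp)
  have hs : IsSymmSndFDerivAt ℝ θ y := hθ.isSymmSndFDerivAt
    (by simpa using WithTop.coe_le_coe.2 (le_top (a := (2 : ℕ∞))))
  have hc : ∀ v w : Model n, HasFDerivAt (fun z => curl θ z v w)
      (((fderiv ℝ (fderiv ℝ θ) y).flip v).flip w - ((fderiv ℝ (fderiv ℝ θ) y).flip w).flip v) y := by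
    intro v w
    have h1 : ∀ v w : Model n, HasFDerivAt (fun z => fderiv ℝ θ z v w)
        (((fderiv ℝ (fderiv ℝ θ) y).flip v).flip w) y := by
      intro v w
      have := (hd.hasFDerivAt.clm_apply (hasFDerivAt_const v y)).clm_apply (hasFDerivAt_const w y)
      refine this.congr_fderiv ?_
      ext z
      simp
    exact (h1 v w).sub (h1 w v)
  -- Leibniz rule: differentiating the k-th factor produces a difference of two second derivatives
  -- of θ.
  have hp : ∀ σ : Equiv.Perm (Fin (2 * n + 1)),
      fderiv ℝ (fun z => ∏ i : Fin n, curl θ z (e (σ ⟨2 * i.1 + 1, by omega⟩))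
        (e (σ ⟨2 * i.1 + 2, by omega⟩))) y (e (σ 0)) =
      ∑ k : Fin n, ((∏ i ∈ Finset.univ.erase k, curl θ y (e (σ ⟨2 * i.1 + 1, by omega⟩))
          (e (σ ⟨2 * i.1 + 2, by omega⟩))) *
          fderiv ℝ (fderiv ℝ θ) y (e (σ 0)) (e (σ ⟨2 * k.1 + 1, by omega⟩))
            (e (σ ⟨2 * k.1 + 2, by omega⟩)) -
        (∏ i ∈ Finset.univ.erase k, curl θ y (e (σ ⟨2 * i.1 + 1, by omega⟩))
          (e (σ ⟨2 * i.1 + 2, by omega⟩))) *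
          fderiv ℝ (fderiv ℝ θ) y (e (σ 0)) (e (σ ⟨2 * k.1 + 2, by omega⟩))
            (e (σ ⟨2 * k.1 + 1, by omega⟩))) := by
    intro σ
    rw [(HasFDerivAt.finsetProd (u := Finset.univ) fun (i : Fin n) _ =>
      hc (e (σ ⟨2 * i.1 + 1, by omega⟩)) (e (σ ⟨2 * i.1 + 2, by omega⟩))).fderiv]
    simp [mul_sub]
  simp_rw [hp, Finset.mul_sum]
  rw [Finset.sum_comm]
  refine Finset.sum_eq_zero fun k _ => ?_
  simp_rw [mul_sub, Finset.sum_sub_distrib]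
  have hne : ∀ i ∈ Finset.univ.erase k, i.1 ≠ k.1 := fun i hi h =>
    Finset.ne_of_mem_erase hi (Fin.ext h)
  have hsw : ∀ (j : Fin (2 * n + 1)), (∀ i ∈ Finset.univ.erase k,
      (⟨2 * i.1 + 1, by omega⟩ : Fin (2 * n + 1)) ≠ j ∧
      (⟨2 * i.1 + 2, by omega⟩ : Fin (2 * n + 1)) ≠ j) → ∀ σ : Equiv.Perm (Fin (2 * n + 1)),
      (∏ i ∈ Finset.univ.erase k,
        curl θ y (e ((σ * Equiv.swap 0 j) ⟨2 * i.1 + 1, by omega⟩))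
          (e ((σ * Equiv.swap 0 j) ⟨2 * i.1 + 2, by omega⟩))) =
      ∏ i ∈ Finset.univ.erase k, curl θ y (e (σ ⟨2 * i.1 + 1, by omega⟩))
          (e (σ ⟨2 * i.1 + 2, by omega⟩)) := by
    intro j hj σ
    refine Finset.prod_congr rfl fun i hi => ?_
    rw [Equiv.Perm.mul_apply, Equiv.Perm.mul_apply,
      Equiv.swap_apply_of_ne_of_ne (by simp [Fin.ext_iff]) (hj i hi).1,
      Equiv.swap_apply_of_ne_of_ne (by simp [Fin.ext_iff]) (hj i hi).2]
  -- D²θ is symmetric in its two differentiation directions. These sit in slots 0 and 2k+1 in the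
  -- first family, 0 and 2k+2 in the second, and swapping them does not touch the other factors.
  rw [sum_sign_eq_zero _ (a := 0) (b := ⟨2 * k.1 + 1, by omega⟩) (by simp [Fin.ext_iff]),
    sum_sign_eq_zero _ (a := 0) (b := ⟨2 * k.1 + 2, by omega⟩) (by simp [Fin.ext_iff]), sub_zero]
  · intro σ
    rw [hsw _ fun i hi => ⟨by have := hne i hi; simp [Fin.ext_iff]; omega,
      by have := hne i hi; simp [Fin.ext_iff]; omega⟩]
    congr 1
    rw [Equiv.Perm.mul_apply, Equiv.Perm.mul_apply, Equiv.Perm.mul_apply, Equiv.swap_apply_left,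
      Equiv.swap_apply_right, Equiv.swap_apply_of_ne_of_ne (by simp [Fin.ext_iff])
      (by simp [Fin.ext_iff]), hs.eq]
  · intro σ
    rw [hsw _ fun i hi => ⟨by have := hne i hi; simp [Fin.ext_iff]; omega,
      by have := hne i hi; simp [Fin.ext_iff]; omega⟩]
    congr 1
    rw [Equiv.Perm.mul_apply, Equiv.Perm.mul_apply, Equiv.Perm.mul_apply, Equiv.swap_apply_left,
      Equiv.swap_apply_right, Equiv.swap_apply_of_ne_of_ne (by simp [Fin.ext_iff])
      (by simp [Fin.ext_iff]), hs.eq]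

/-- The density of `θ ∧ (dθ)^n`. -/
def modelVol (θ : Model n → Model n →L[ℝ] ℝ) (y : Model n) : ℝ :=
  topForm (θ y).toLinearMap (toBilin (curl θ y)) (stdBasis n)

theorem contDiffOn_modelVol {θ : Model n → Model n →L[ℝ] ℝ} {U : Set (Model n)} (hU : IsOpen U)
    (hθ : ContDiffOn ℝ ∞ θ U) : ContDiffOn ℝ ∞ (modelVol θ) U := by
  have hc := contDiffOn_curl hU hθ
  unfold modelVol topForm
  refine contDiffOn_const.mul (ContDiffOn.sum fun σ _ => contDiffOn_const.mul ?_)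
  refine (hθ.clm_apply contDiffOn_const).mul (contDiffOn_prod fun i _ => ?_)
  exact (hc.clm_apply contDiffOn_const).clm_apply contDiffOn_const

theorem modelVol_pullback {θ : Model n → Model n →L[ℝ] ℝ} {g : Model n → Model n} {y : Model n}
    (hg : ContDiffAt ℝ ∞ g y) (hθ : DifferentiableAt ℝ θ (g y)) :
    modelVol (fun z => (θ (g z)).comp (fderiv ℝ g z)) y =
      (fderiv ℝ g y).det * modelVol θ (g y) := by
  rw [modelVol, modelVol, ContinuousLinearMap.det, ← topForm_map]
  simp [topForm, curl_pullback hg hθ]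

theorem modelVol_congr {θ η : Model n → Model n →L[ℝ] ℝ} {y : Model n} (h : θ =ᶠ[𝓝 y] η) :
    modelVol θ y = modelVol η y := by
  rw [modelVol, modelVol, curl_congr h, h.eq_of_nhds]

/-- df ∧ (dθ)^n = d(f (dθ)^n) is exact with compact support: move the derivative off `f` in every
coefficient and use that (dθ)^n is closed. The sign converts the oriented density into the positive
one used by the measure. The density has no zeros in `U`, so the sign is locally constant there and
contributes no derivative. -/
theorem integral_sign_mul_topForm_fderiv_eq_zero {θ : Model n → Model n →L[ℝ] ℝ}
    {U : Set (Model n)} (hU : IsOpen U) (hθ : ContDiffOn ℝ ∞ θ U) (hv : ∀ y ∈ U, modelVol θ y ≠ 0)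
    {f : Model n → ℝ} (hf : ContDiff ℝ ∞ f) (hfc : HasCompactSupport f) (hfU : tsupport f ⊆ U) :
    ∫ y, (SignType.sign (modelVol θ y) : ℝ) *
      topForm (fderiv ℝ f y).toLinearMap (toBilin (curl θ y)) (stdBasis n) = 0 := by
  have hc := contDiffOn_curl hU hθ
  set P : Equiv.Perm (Fin (2 * n + 1)) → Model n → ℝ := fun σ z =>
    ∏ i : Fin n, curl θ z (stdBasis n (σ ⟨2 * i.1 + 1, by omega⟩))
        (stdBasis n (σ ⟨2 * i.1 + 2, by omega⟩)) with hP
  have hPs : ∀ σ, ContDiffOn ℝ ∞ (P σ) U := fun σ =>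
    contDiffOn_prod fun i _ => (hc.clm_apply contDiffOn_const).clm_apply contDiffOn_const
  have hPd : ∀ σ, ∀ y ∈ U, DifferentiableAt ℝ (P σ) y := fun σ y hy =>
    ((hPs σ).contDiffAt (hU.mem_nhds hy)).differentiableAt (by simp)
  have hPf : ∀ σ v, ContinuousOn (fun y => fderiv ℝ (P σ) y v) U := fun σ v =>
    (((hPs σ).fderiv_of_isOpen (m := 0) hU (by norm_cast)).clm_apply contDiffOn_const).continuousOn
  set s : Model n → ℝ := fun y => (SignType.sign (modelVol θ y) : ℝ) with hs
  have hvc : ContinuousOn (modelVol θ) U := (contDiffOn_modelVol hU hθ).continuousOn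
  have hsl : ∀ y ∈ U, s =ᶠ[𝓝 y] fun _ => s y := by
    intro y hy
    have hcy := hvc.continuousAt (hU.mem_nhds hy)
    rcases lt_or_gt_of_ne (hv y hy) with h | h
    · filter_upwards [hcy.eventually (gt_mem_nhds h)] with z hz
      simp [hs, sign_neg h, sign_neg hz]
    · filter_upwards [hcy.eventually (lt_mem_nhds h)] with z hz
      simp [hs, sign_pos h, sign_pos hz]
  have hsc : ContinuousOn s U := fun y hy =>
    ((continuousAt_const (y := s y)).congr (hsl y hy).symm).continuousWithinAt
  -- The coefficients are controlled only on `U`; the compact support of `f` inside `U` makes the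
  -- products integrable on the whole space.
  have hint : ∀ {g h : Model n → ℝ}, Continuous h → tsupport h ⊆ tsupport f → ContinuousOn g U →
      Integrable (fun y => h y * g y) := by
    intro g h hh hsupp hg
    have hK : IsCompact (tsupport f) := hfc
    have h1 : IntegrableOn (fun y => h y * g y) (tsupport f) :=
      (hh.continuousOn.mul (hg.mono hfU)).integrableOn_compact hK
    refine (integrableOn_iff_integrable_of_support_subset fun y hy => ?_).1 h1
    refine hsupp (subset_tsupport _ ?_)
    exact left_ne_zero_of_mul hy
  have hfd : ∀ v, tsupport (fun y => fderiv ℝ f y v) ⊆ tsupport f := fun v =>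
    tsupport_fderiv_apply_subset ℝ v
  have hfdc : ∀ v, Continuous (fun y => fderiv ℝ f y v) := fun v =>
    (hf.continuous_fderiv (by simp)).clm_apply continuous_const
  have hsP : ∀ σ, ∀ y ∈ U, HasFDerivAt (fun z => s z * P σ z) (s y • fderiv ℝ (P σ) y) y := by
    intro σ y hy
    refine ((hPd σ y hy).hasFDerivAt.const_mul (s y)).congr_of_eventuallyEq ?_
    filter_upwards [hsl y hy] with z hz
    rw [hz]
  have hparts : ∀ σ : Equiv.Perm (Fin (2 * n + 1)),
      ∫ y, fderiv ℝ f y (stdBasis n (σ 0)) * (s y * P σ y) =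
        -∫ y, f y * (s y * fderiv ℝ (P σ) y (stdBasis n (σ 0))) := by
    intro σ
    have hfd' : ∀ y, f y * fderiv ℝ (fun z => s z * P σ z) y (stdBasis n (σ 0)) =
        f y * (s y * fderiv ℝ (P σ) y (stdBasis n (σ 0))) := by
      intro y
      by_cases hy : y ∈ tsupport f
      · rw [(hsP σ y (hfU hy)).fderiv]; simp
      · simp [image_eq_zero_of_notMem_tsupport hy]
    have := integral_mul_fderiv_eq_neg_fderiv_mul_of_integrable (μ := (volume : Measure (Model n)))
      (f := f) (g := fun z => s z * P σ z) (v := stdBasis n (σ 0))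
      (hint (hfdc _) (hfd _) (hsc.mul (hPs σ).continuousOn))
      (by simp_rw [hfd']
          exact hint hf.continuous subset_rfl (hsc.mul (hPf σ _)))
      (hint hf.continuous subset_rfl (hsc.mul (hPs σ).continuousOn))
      (fun y _ => hf.differentiable (by simp) y)
      (fun y hy => (hsP σ y (hfU hy)).differentiableAt)
    simp_rw [hfd'] at this
    rw [this, neg_neg]
  calc ∫ y, s y * topForm (fderiv ℝ f y).toLinearMap (toBilin (curl θ y)) (stdBasis n)
      = ∫ y, (1 / 2 : ℝ) ^ n * ∑ σ : Equiv.Perm (Fin (2 * n + 1)),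
          ((Equiv.Perm.sign σ : ℤ) : ℝ) * (fderiv ℝ f y (stdBasis n (σ 0)) * (s y * P σ y)) := by
        refine integral_congr_ae (.of_forall fun y => ?_)
        simp only [topForm, hP, Finset.mul_sum]
        refine Finset.sum_congr rfl fun σ _ => ?_
        simp only [ContinuousLinearMap.coe_coe, toBilin_apply]
        ring
    _ = (1 / 2 : ℝ) ^ n * ∑ σ : Equiv.Perm (Fin (2 * n + 1)),
          ((Equiv.Perm.sign σ : ℤ) : ℝ) *
            -∫ y, f y * (s y * fderiv ℝ (P σ) y (stdBasis n (σ 0))) := by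
        rw [integral_const_mul, integral_finsetSum]
        · simp_rw [integral_const_mul, hparts]
        · intro σ _
          exact (hint (hfdc _) (hfd _) (hsc.mul (hPs σ).continuousOn)).const_mul _
    _ = -((1 / 2 : ℝ) ^ n * ∫ y, f y * (s y * ∑ σ : Equiv.Perm (Fin (2 * n + 1)),
          ((Equiv.Perm.sign σ : ℤ) : ℝ) * fderiv ℝ (P σ) y (stdBasis n (σ 0)))) := by
        rw [← mul_neg]
        congr 1
        simp_rw [mul_neg, Finset.sum_neg_distrib, ← integral_const_mul]
        rw [← integral_finsetSum]
        · congr 1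
          refine integral_congr_ae (.of_forall fun y => ?_)
          simp only [Finset.mul_sum]
          refine Finset.sum_congr rfl fun σ _ => ?_
          ring
        · intro σ _
          exact (hint hf.continuous subset_rfl (hsc.mul (hPf σ _))).const_mul _
    _ = 0 := by
        rw [integral_eq_zero_of_ae, mul_zero, neg_zero]
        refine .of_forall fun y => ?_
        by_cases hy : y ∈ tsupport f
        · have := sum_sign_fderiv_prod_curl_eq_zero (hθ.contDiffAt (hU.mem_nhds (hfU hy)))
            (stdBasis n)
          simp only [hP, this, mul_zero, Pi.zero_apply]
        · simp [image_eq_zero_of_notMem_tsupport hy]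

end Model

/-! ### Smooth sections in charts -/

section Charts

variable {n : ℕ} {M : Type*} [TopologicalSpace M] [ChartedSpace (Model n) M]

theorem isOpen_chart_target (c : M) : IsOpen (extChartAt (𝓡 (2 * n + 1)) c).target :=
  isOpen_extChartAt_target c

/-- The derivative of a map from the model space to the manifold. -/
def push (p : Model n → M) (y : Model n) : Model n →L[ℝ] TangentSpace (𝓡 (2 * n + 1)) (p y) :=
  mfderiv 𝓘(ℝ, Model n) (𝓡 (2 * n + 1)) p y

/-- The derivative of a map from the manifold to the model space. -/
def coordDeriv (g : M → Model n) (x : M) : TangentSpace (𝓡 (2 * n + 1)) x →L[ℝ] Model n :=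
  mfderiv (𝓡 (2 * n + 1)) 𝓘(ℝ, Model n) g x

theorem formInChart_eq (α : OneForm n M) (c : M) (y : Model n) :
    formInChart α c y = (α ((extChartAt (𝓡 (2 * n + 1)) c).symm y)).comp
      (push (extChartAt (𝓡 (2 * n + 1)) c).symm y) := rfl

/-- All tangent spaces are definitionally `Model n`, so the same vector may be used at a
propositionally equal base point without a cast. -/
theorem form_apply_congr (α : OneForm n M) {x y : M} (h : x = y) (v : Model n) :
    α x v = α y v := by
  subst h; rfl

theorem formInChart_apply (α : OneForm n M) {c x : M}
    (hx : x ∈ (extChartAt (𝓡 (2 * n + 1)) c).source) (v : Model n) :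
    formInChart α c (extChartAt (𝓡 (2 * n + 1)) c x) v =
      α x (show Model n from
        push (extChartAt (𝓡 (2 * n + 1)) c).symm (extChartAt (𝓡 (2 * n + 1)) c x) v) :=
  form_apply_congr α ((extChartAt (𝓡 (2 * n + 1)) c).left_inv hx) _

/-- The vector field `X` read in the preferred chart at `c`. -/
def fieldInChart (X : VField n M) (c : M) (y : Model n) : Model n :=
  coordDeriv (extChartAt (𝓡 (2 * n + 1)) c)
    ((extChartAt (𝓡 (2 * n + 1)) c).symm y) (X ((extChartAt (𝓡 (2 * n + 1)) c).symm y))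

variable [IsManifold (𝓡 (2 * n + 1)) ∞ M]

instance isManifold_one : IsManifold (𝓡 (2 * n + 1)) 1 M :=
  IsManifold.of_le (n := ∞) (by exact_mod_cast le_top)

theorem contMDiffOn_chart (c : M) : ContMDiffOn (𝓡 (2 * n + 1)) 𝓘(ℝ, Model n) ∞
    (extChartAt (𝓡 (2 * n + 1)) c) (extChartAt (𝓡 (2 * n + 1)) c).source := by
  simpa using contMDiffOn_extChartAt (I := 𝓡 (2 * n + 1)) (n := ∞) (x := c)

theorem contMDiffOn_chart_symm (c : M) : ContMDiffOn 𝓘(ℝ, Model n) (𝓡 (2 * n + 1)) ∞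
    (extChartAt (𝓡 (2 * n + 1)) c).symm (extChartAt (𝓡 (2 * n + 1)) c).target :=
  contMDiffOn_extChartAt_symm c

/-- The tangent vectors `f_* v` depend smoothly on the point. -/
theorem contMDiffOn_mfderiv_const {U : Set (Model n)} (hU : IsOpen U) {f : Model n → M}
    (hf : ContMDiffOn 𝓘(ℝ, Model n) (𝓡 (2 * n + 1)) ∞ f U) (v : Model n) :
    ContMDiffOn 𝓘(ℝ, Model n) (𝓡 (2 * n + 1)).tangent ∞
      (fun y => (⟨f y, push f y v⟩ :
        TangentBundle (𝓡 (2 * n + 1)) M)) U := by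
  have h1 : ContMDiffOn 𝓘(ℝ, Model n) 𝓘(ℝ, Model n).tangent ∞
      (fun y => (⟨y, v⟩ : TangentBundle 𝓘(ℝ, Model n) (Model n))) U :=
    contMDiffOn_vectorSpace_iff_contDiffOn.2 contDiffOn_const
  have h2 := hf.contMDiffOn_tangentMapWithin (m := ∞) (by simp) hU.uniqueMDiffOn
  refine (h2.comp h1 fun y hy => hy).congr fun y hy => ?_
  simp only [Function.comp, tangentMapWithin]
  rw [mfderivWithin_of_isOpen hU hy]
  rfl

theorem contDiffOn_mfderiv_apply {U : Set (Model n)} {f : Model n → M}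
    {X : ∀ y, TangentSpace (𝓡 (2 * n + 1)) (f y)}
    (hX : ContMDiffOn 𝓘(ℝ, Model n) (𝓡 (2 * n + 1)).tangent ∞
      (fun y => (⟨f y, X y⟩ : TangentBundle (𝓡 (2 * n + 1)) M)) U)
    {V : Set M} (hV : IsOpen V) {g : M → Model n}
    (hg : ContMDiffOn (𝓡 (2 * n + 1)) 𝓘(ℝ, Model n) ∞ g V) (hfV : MapsTo f U V) :
    ContDiffOn ℝ ∞ (fun y => coordDeriv g (f y) (X y)) U := by
  have h2 := hg.contMDiffOn_tangentMapWithin (m := ∞) (by simp) hV.uniqueMDiffOn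
  have h3 := (contMDiff_snd_tangentBundle_modelSpace (Model n) 𝓘(ℝ, Model n)).comp_contMDiffOn
    (h2.comp hX fun y hy => hfV hy)
  refine h3.contDiffOn.congr fun y hy => ?_
  simp only [Function.comp, tangentMapWithin]
  rw [mfderivWithin_of_isOpen hV (hfV hy)]
  rfl

/-- The vector field lives along a map `f` from an arbitrary manifold because three sources are
needed: the model space (chart expressions), `M` itself, and the tangent bundle
(`SmoothForm.toContinuousMap`). -/
theorem SmoothForm.contMDiffWithinAt_apply {α : OneForm n M} (hα : SmoothForm α)
    {E' : Type*} [NormedAddCommGroup E'] [NormedSpace ℝ E'] {H' : Type*} [TopologicalSpace H']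
    {I' : ModelWithCorners ℝ E' H'} {N : Type*} [TopologicalSpace N] [ChartedSpace H' N]
    {U : Set N} {f : N → M} {X : ∀ y, TangentSpace (𝓡 (2 * n + 1)) (f y)} {x : N}
    (hX : ContMDiffWithinAt I' (𝓡 (2 * n + 1)).tangent ∞
      (fun y => (⟨f y, X y⟩ : TangentBundle (𝓡 (2 * n + 1)) M)) U x) :
    ContMDiffWithinAt I' 𝓘(ℝ, ℝ) ∞ (fun y => α (f y) (X y)) U x := by
  have hf : ContMDiffWithinAt I' (𝓡 (2 * n + 1)) ∞ f U x := (contMDiffWithinAt_totalSpace.1 hX).1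
  have hα' := (hα (f x)).comp_contMDiffWithinAt x hf
  have := ContMDiffWithinAt.clm_bundle_apply (F₁ := Model n) (F₂ := ℝ)
    (E₁ := fun x : M => TangentSpace (𝓡 (2 * n + 1)) x) (E₂ := fun x : M => Trivial M ℝ x)
    (b := f) (ϕ := fun y => α (f y)) (v := X) hα' hX
  exact (contMDiffWithinAt_totalSpace.1 this).2

theorem SmoothForm.contDiffOn_comp {α : OneForm n M} (hα : SmoothForm α) {U : Set (Model n)}
    (hU : IsOpen U) {f : Model n → M} (hf : ContMDiffOn 𝓘(ℝ, Model n) (𝓡 (2 * n + 1)) ∞ f U) :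
    ContDiffOn ℝ ∞ (fun y => (α (f y)).comp (push f y)) U := by
  refine contDiffOn_clm_apply.2 fun v => ?_
  have h : ContMDiffOn 𝓘(ℝ, Model n) 𝓘(ℝ, ℝ) ∞
      (fun y => α (f y) (push f y v)) U := fun y hy =>
    hα.contMDiffWithinAt_apply (contMDiffOn_mfderiv_const hU hf v y hy)
  exact h.contDiffOn

theorem SmoothForm.contDiffOn_formInChart {α : OneForm n M} (hα : SmoothForm α) (c : M) :
    ContDiffOn ℝ ∞ (formInChart α c) (extChartAt (𝓡 (2 * n + 1)) c).target :=
  hα.contDiffOn_comp (isOpen_chart_target c) (contMDiffOn_chart_symm c)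

/-- Near `c` the bundle trivialization at `c` is the derivative of the preferred chart, so the local
representative of the section is `formInChart α c` composed with that chart. -/
theorem smoothForm_of_chart {α : OneForm n M} (h : ∀ c, ContDiffOn ℝ ∞ (formInChart α c)
    (extChartAt (𝓡 (2 * n + 1)) c).target) : SmoothForm α := by
  intro c
  rw [contMDiffAt_hom_bundle]
  refine ⟨contMDiffAt_id, ?_⟩
  have hc := (h c).contDiffAt ((isOpen_chart_target c).mem_nhds (mem_extChartAt_target c))
  have := hc.contMDiffAt.comp c ((contMDiffOn_chart c).contMDiffAt
    ((isOpen_extChartAt_source c).mem_nhds (mem_extChartAt_source c)))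
  refine this.congr_of_eventuallyEq ?_
  filter_upwards [(isOpen_extChartAt_source (I := 𝓡 (2 * n + 1)) c).mem_nhds
    (mem_extChartAt_source c)] with x hx
  have hx' : x ∈ (chartAt (Model n) c).source := by simpa using hx
  rw [ContinuousLinearMap.inCoordinates, TangentBundle.symmL_trivializationAt hx']
  ext v
  rw [Function.comp_apply, formInChart_apply α hx]
  have hr : range (𝓡 (2 * n + 1)) = univ := ModelWithCorners.range_eq_univ _
  rw [hr, mfderivWithin_univ]
  simp
  rfl

theorem smoothField_of_chart {X : VField n M} (h : ∀ c, ContDiffOn ℝ ∞ (fieldInChart X c)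
    (extChartAt (𝓡 (2 * n + 1)) c).target) : SmoothField X := by
  intro c
  refine (contMDiffAt_section c).2 ?_
  have hc := (h c).contDiffAt ((isOpen_chart_target c).mem_nhds (mem_extChartAt_target c))
  have := hc.contMDiffAt.comp c ((contMDiffOn_chart c).contMDiffAt
    ((isOpen_extChartAt_source c).mem_nhds (mem_extChartAt_source c)))
  refine this.congr_of_eventuallyEq ?_
  filter_upwards [(isOpen_extChartAt_source (I := 𝓡 (2 * n + 1)) c).mem_nhds
    (mem_extChartAt_source c)] with x hx
  have hx' : x ∈ (chartAt (Model n) c).source := by simpa using hx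
  have := TangentBundle.continuousLinearMapAt_trivializationAt (I := 𝓡 (2 * n + 1)) hx'
  have e : fieldInChart X c (extChartAt (𝓡 (2 * n + 1)) c x) =
      coordDeriv (extChartAt (𝓡 (2 * n + 1)) c) x (X x) := by
    rw [fieldInChart, (extChartAt (𝓡 (2 * n + 1)) c).left_inv hx]
  have hb : x ∈ (trivializationAt (Model n)
      (TangentSpace (𝓡 (2 * n + 1)) : M → Type _) c).baseSet := by simpa using hx'
  rw [Function.comp_apply, e, coordDeriv, ← this]
  exact (congrFun (Trivialization.coe_linearMapAt_of_mem (R := ℝ) _ hb) (X x)).symm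

end Charts

/-! ### Calculus of one-forms on the manifold -/

section Calculus

variable {n : ℕ} {M : Type*} [TopologicalSpace M] [ChartedSpace (Model n) M]

theorem formInChart_add (α β : OneForm n M) (c : M) :
    formInChart (α + β) c = formInChart α c + formInChart β c := by
  ext y v; rfl

theorem formInChart_smul (t : ℝ) (α : OneForm n M) (c : M) :
    formInChart (t • α) c = t • formInChart α c := by
  ext y v; rfl

theorem formInChart_fun_smul (f : M → ℝ) (α : OneForm n M) (c : M) :
    formInChart (fun x => f x • α x) c =
      fun y => f ((extChartAt (𝓡 (2 * n + 1)) c).symm y) • formInChart α c y := by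
  ext y v; rfl

theorem extD_apply (α : OneForm n M) (x : M) (v w : TangentSpace (𝓡 (2 * n + 1)) x) :
    extD α x v w = curl (formInChart α x) (extChartAt (𝓡 (2 * n + 1)) x x)
      (coordDeriv (extChartAt (𝓡 (2 * n + 1)) x) x v)
      (coordDeriv (extChartAt (𝓡 (2 * n + 1)) x) x w) := rfl

theorem extD_skew (α : OneForm n M) (x : M) (v w : TangentSpace (𝓡 (2 * n + 1)) x) :
    extD α x v w = -extD α x w v := by
  rw [extD_apply, extD_apply, curl_skew]

/-- `extD α x` as a bilinear form. -/
def extDBilin (α : OneForm n M) (x : M) :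
    TangentSpace (𝓡 (2 * n + 1)) x →ₗ[ℝ] TangentSpace (𝓡 (2 * n + 1)) x →ₗ[ℝ] ℝ :=
  LinearMap.mk₂ ℝ (fun v w => extD α x v w)
    (fun v v' w => by simp [extD_apply]) (fun r v w => by simp [extD_apply])
    (fun v w w' => by simp) (fun r v w => by simp)

@[simp] theorem extDBilin_apply (α : OneForm n M) (x : M)
    (v w : TangentSpace (𝓡 (2 * n + 1)) x) : extDBilin α x v w = extD α x v w := rfl

theorem volForm_eq_topForm (α : OneForm n M) (x : M)
    (v : Fin (2 * n + 1) → TangentSpace (𝓡 (2 * n + 1)) x) :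
    volForm α x v = topForm (α x).toLinearMap (extDBilin α x) v := rfl

theorem finrank_tangentSpace (x : M) :
    Module.finrank ℝ (TangentSpace (𝓡 (2 * n + 1)) x) = 2 * n + 1 :=
  finrank_euclideanSpace_fin (𝕜 := ℝ) (n := 2 * n + 1)

instance finiteDimensional_tangentSpace (x : M) :
    FiniteDimensional ℝ (TangentSpace (𝓡 (2 * n + 1)) x) :=
  inferInstanceAs (FiniteDimensional ℝ (Model n))

variable [IsManifold (𝓡 (2 * n + 1)) ∞ M]

theorem SmoothForm.add {α β : OneForm n M} (hα : SmoothForm α) (hβ : SmoothForm β) :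
    SmoothForm (α + β) :=
  smoothForm_of_chart fun c => by
    rw [formInChart_add]
    exact (hα.contDiffOn_formInChart c).add (hβ.contDiffOn_formInChart c)

theorem SmoothForm.const_smul {α : OneForm n M} (hα : SmoothForm α) (t : ℝ) :
    SmoothForm (t • α) :=
  smoothForm_of_chart fun c => by
    rw [formInChart_smul]
    exact contDiffOn_const.smul (hα.contDiffOn_formInChart c)

theorem SmoothForm.sub {α β : OneForm n M} (hα : SmoothForm α) (hβ : SmoothForm β) :
    SmoothForm (α - β) := by
  have h : α - β = α + (-1 : ℝ) • β := by rw [neg_one_smul ℝ β, sub_eq_add_neg]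
  rw [h]
  exact hα.add (hβ.const_smul (-1))

theorem smoothForm_zero : SmoothForm (0 : OneForm n M) :=
  smoothForm_of_chart fun c => by
    have : formInChart (0 : OneForm n M) c = fun _ => 0 := by ext y v; rfl
    rw [this]
    exact contDiffOn_const

theorem contDiffOn_chart_symm {E' : Type*} [NormedAddCommGroup E'] [NormedSpace ℝ E'] {f : M → E'}
    (hf : ContMDiff (𝓡 (2 * n + 1)) 𝓘(ℝ, E') ∞ f) (c : M) :
    ContDiffOn ℝ ∞ (fun y => f ((extChartAt (𝓡 (2 * n + 1)) c).symm y))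
      (extChartAt (𝓡 (2 * n + 1)) c).target :=
  (hf.comp_contMDiffOn (contMDiffOn_chart_symm c)).contDiffOn

theorem SmoothForm.fun_smul {α : OneForm n M} (hα : SmoothForm α) {f : M → ℝ}
    (hf : ContMDiff (𝓡 (2 * n + 1)) 𝓘(ℝ, ℝ) ∞ f) : SmoothForm (fun x => f x • α x) :=
  smoothForm_of_chart fun c => by
    rw [formInChart_fun_smul]
    exact (contDiffOn_chart_symm hf c).smul (hα.contDiffOn_formInChart c)

theorem SmoothForm.contMDiff_apply {α : OneForm n M} (hα : SmoothForm α) {X : VField n M}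
    (hX : SmoothField X) : ContMDiff (𝓡 (2 * n + 1)) 𝓘(ℝ, ℝ) ∞ (fun x => α x (X x)) := fun x =>
  hα.contMDiffWithinAt_apply (U := univ) (f := id) (X := X) (x := x) (hX x)

theorem mdifferentiableAt_chart_symm {c : M} {y : Model n}
    (hy : y ∈ (extChartAt (𝓡 (2 * n + 1)) c).target) :
    MDifferentiableAt 𝓘(ℝ, Model n) (𝓡 (2 * n + 1)) (extChartAt (𝓡 (2 * n + 1)) c).symm y :=
  ((contMDiffOn_chart_symm c).contMDiffAt ((isOpen_chart_target c).mem_nhds hy)).mdifferentiableAt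
    (by simp)

theorem mdifferentiableAt_chart {c x : M} (hx : x ∈ (extChartAt (𝓡 (2 * n + 1)) c).source) :
    MDifferentiableAt (𝓡 (2 * n + 1)) 𝓘(ℝ, Model n) (extChartAt (𝓡 (2 * n + 1)) c) x :=
  ((contMDiffOn_chart c).contMDiffAt ((isOpen_extChartAt_source c).mem_nhds hx)).mdifferentiableAt
    (by simp)

theorem mfderiv_chart_mfderiv_symm {c : M} {y : Model n}
    (hy : y ∈ (extChartAt (𝓡 (2 * n + 1)) c).target) (v : Model n) :
    coordDeriv (extChartAt (𝓡 (2 * n + 1)) c) ((extChartAt (𝓡 (2 * n + 1)) c).symm y)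
      (push (extChartAt (𝓡 (2 * n + 1)) c).symm y v) = v := by
  have h := mfderiv_comp_apply y (mdifferentiableAt_chart
    ((extChartAt (𝓡 (2 * n + 1)) c).map_target hy)) (mdifferentiableAt_chart_symm hy) v
  refine h.symm.trans ?_
  have : (extChartAt (𝓡 (2 * n + 1)) c) ∘ (extChartAt (𝓡 (2 * n + 1)) c).symm =ᶠ[𝓝 y] id := by
    filter_upwards [(isOpen_chart_target c).mem_nhds hy] with z hz
    exact (extChartAt (𝓡 (2 * n + 1)) c).right_inv hz
  rw [this.mfderiv_eq, mfderiv_id]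
  rfl

theorem mfderiv_symm_mfderiv_chart {c x : M} (hx : x ∈ (extChartAt (𝓡 (2 * n + 1)) c).source)
    (v : TangentSpace (𝓡 (2 * n + 1)) x) :
    (show Model n from push (extChartAt (𝓡 (2 * n + 1)) c).symm (extChartAt (𝓡 (2 * n + 1)) c x)
      (coordDeriv (extChartAt (𝓡 (2 * n + 1)) c) x v)) = v := by
  have h := mfderiv_comp_apply x (mdifferentiableAt_chart_symm
    ((extChartAt (𝓡 (2 * n + 1)) c).map_source hx)) (mdifferentiableAt_chart hx) v
  refine h.symm.trans ?_
  have : (extChartAt (𝓡 (2 * n + 1)) c).symm ∘ (extChartAt (𝓡 (2 * n + 1)) c) =ᶠ[𝓝 x] id := by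
    filter_upwards [(isOpen_extChartAt_source c).mem_nhds hx] with z hz
    exact (extChartAt (𝓡 (2 * n + 1)) c).left_inv hz
  rw [this.mfderiv_eq, mfderiv_id]
  rfl

theorem fderiv_chart_comp {U : Set (Model n)} (hU : IsOpen U) {p : Model n → M}
    (hp : ContMDiffOn 𝓘(ℝ, Model n) (𝓡 (2 * n + 1)) ∞ p U) {c : M} {y : Model n} (hy : y ∈ U)
    (hc : p y ∈ (extChartAt (𝓡 (2 * n + 1)) c).source) (u : Model n) :
    fderiv ℝ (fun z => extChartAt (𝓡 (2 * n + 1)) c (p z)) y u =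
      coordDeriv (extChartAt (𝓡 (2 * n + 1)) c) (p y) (push p y u) := by
  have := mfderiv_comp_apply y (mdifferentiableAt_chart hc)
    ((hp.contMDiffAt (hU.mem_nhds hy)).mdifferentiableAt (by simp)) u
  rw [mfderiv_eq_fderiv] at this
  exact this

theorem contDiffAt_chart_comp {U : Set (Model n)} (hU : IsOpen U) {p : Model n → M}
    (hp : ContMDiffOn 𝓘(ℝ, Model n) (𝓡 (2 * n + 1)) ∞ p U) {c : M} {y : Model n} (hy : y ∈ U)
    (hc : p y ∈ (extChartAt (𝓡 (2 * n + 1)) c).source) :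
    ContDiffAt ℝ ∞ (fun z => extChartAt (𝓡 (2 * n + 1)) c (p z)) y := by
  have h1 : ContMDiffAt (𝓡 (2 * n + 1)) 𝓘(ℝ, Model n) ∞ (extChartAt (𝓡 (2 * n + 1)) c) (p y) :=
    (contMDiffOn_chart c).contMDiffAt ((isOpen_extChartAt_source c).mem_nhds hc)
  exact (h1.comp y (hp.contMDiffAt (hU.mem_nhds hy))).contDiffAt

/-- Factoring `p` through the preferred chart at `c` writes p^*α as the pull-back of a form on the
model space by a map of the model space. Naturality statements on `M` thereby reduce to
`curl_pullback` and `modelVol_pullback`. -/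
theorem eventuallyEq_formInChart_comp (α : OneForm n M) {U : Set (Model n)}
    (hU : IsOpen U) {p : Model n → M} (hp : ContMDiffOn 𝓘(ℝ, Model n) (𝓡 (2 * n + 1)) ∞ p U)
    {c : M} {y : Model n} (hy : y ∈ U) (hc : p y ∈ (extChartAt (𝓡 (2 * n + 1)) c).source) :
    (fun z => (α (p z)).comp (push p z)) =ᶠ[𝓝 y]
      fun z => (formInChart α c (extChartAt (𝓡 (2 * n + 1)) c (p z))).comp
        (fderiv ℝ (fun z => extChartAt (𝓡 (2 * n + 1)) c (p z)) z) := by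
  have hsrc : ∀ᶠ z in 𝓝 y, p z ∈ (extChartAt (𝓡 (2 * n + 1)) c).source :=
    (hp.contMDiffAt (hU.mem_nhds hy)).continuousAt.eventually
      ((isOpen_extChartAt_source c).mem_nhds hc)
  filter_upwards [hsrc, hU.mem_nhds hy] with z hz hzU
  ext u
  rw [ContinuousLinearMap.comp_apply, ContinuousLinearMap.comp_apply,
    fderiv_chart_comp hU hp hzU hz u, formInChart_apply α hz]
  exact congrArg (α (p z)) (mfderiv_symm_mfderiv_chart hz _).symm

theorem SmoothForm.differentiableAt_formInChart {α : OneForm n M} (hα : SmoothForm α) {c : M}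
    {y : Model n} (hy : y ∈ (extChartAt (𝓡 (2 * n + 1)) c).target) :
    DifferentiableAt ℝ (formInChart α c) y :=
  ((hα.contDiffOn_formInChart c).contDiffAt ((isOpen_chart_target c).mem_nhds hy)).differentiableAt
    (by simp)

/-- The exterior derivative is natural with respect to maps from the model space. -/
theorem curl_comp_mfderiv {α : OneForm n M} (hα : SmoothForm α) {U : Set (Model n)}
    (hU : IsOpen U) {p : Model n → M} (hp : ContMDiffOn 𝓘(ℝ, Model n) (𝓡 (2 * n + 1)) ∞ p U)
    {y : Model n} (hy : y ∈ U) (v w : Model n) :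
    curl (fun z => (α (p z)).comp (push p z)) y v w =
      extD α (p y) (push p y v) (push p y w) := by
  have hc := mem_extChartAt_source (I := 𝓡 (2 * n + 1)) (p y)
  rw [curl_congr (eventuallyEq_formInChart_comp α hU hp hy hc),
    curl_pullback (contDiffAt_chart_comp hU hp hy hc)
      (hα.differentiableAt_formInChart (mem_extChartAt_target _)), fderiv_chart_comp hU hp hy hc,
    fderiv_chart_comp hU hp hy hc]
  rfl

theorem curl_formInChart {α : OneForm n M} (hα : SmoothForm α) {c : M} {y : Model n}
    (hy : y ∈ (extChartAt (𝓡 (2 * n + 1)) c).target) (v w : Model n) :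
    curl (formInChart α c) y v w = extD α ((extChartAt (𝓡 (2 * n + 1)) c).symm y)
      (push (extChartAt (𝓡 (2 * n + 1)) c).symm y v)
      (push (extChartAt (𝓡 (2 * n + 1)) c).symm y w) :=
  curl_comp_mfderiv hα (isOpen_chart_target c) (contMDiffOn_chart_symm c) hy v w

theorem modelVol_formInChart {α : OneForm n M} (hα : SmoothForm α) {c : M} {y : Model n}
    (hy : y ∈ (extChartAt (𝓡 (2 * n + 1)) c).target) :
    modelVol (formInChart α c) y = volForm α ((extChartAt (𝓡 (2 * n + 1)) c).symm y)
      (fun i => push (extChartAt (𝓡 (2 * n + 1)) c).symm y (EuclideanSpace.single i (1 : ℝ))) := by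
  simp only [modelVol, volForm, topForm, toBilin_apply, curl_formInChart hα hy, stdBasis_apply]
  rfl

theorem formInChart_pullback {f : M → M} (hf : ContMDiff (𝓡 (2 * n + 1)) (𝓡 (2 * n + 1)) ∞ f)
    (α : OneForm n M) {c : M} {y : Model n} (hy : y ∈ (extChartAt (𝓡 (2 * n + 1)) c).target) :
    formInChart (pullback f α) c y =
      (α ((f ∘ (extChartAt (𝓡 (2 * n + 1)) c).symm) y)).comp
        (push (f ∘ (extChartAt (𝓡 (2 * n + 1)) c).symm) y) := by
  ext v
  have := mfderiv_comp_apply y (hf.mdifferentiableAt (by simp)) (mdifferentiableAt_chart_symm hy) v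
  exact congrArg (α (f ((extChartAt (𝓡 (2 * n + 1)) c).symm y))) this.symm

theorem SmoothForm.pullback {f : M → M} (hf : ContMDiff (𝓡 (2 * n + 1)) (𝓡 (2 * n + 1)) ∞ f)
    {α : OneForm n M} (hα : SmoothForm α) : SmoothForm (pullback f α) :=
  smoothForm_of_chart fun c =>
    (hα.contDiffOn_comp (isOpen_chart_target c)
      (hf.comp_contMDiffOn (contMDiffOn_chart_symm c))).congr fun _ hy =>
        formInChart_pullback hf α hy

theorem extD_pullback {f : M → M} (hf : ContMDiff (𝓡 (2 * n + 1)) (𝓡 (2 * n + 1)) ∞ f)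
    {α : OneForm n M} (hα : SmoothForm α) (x : M) (v w : TangentSpace (𝓡 (2 * n + 1)) x) :
    extD (StrictContact.pullback f α) x v w =
      extD α (f x) (mfderiv (𝓡 (2 * n + 1)) (𝓡 (2 * n + 1)) f x v)
        (mfderiv (𝓡 (2 * n + 1)) (𝓡 (2 * n + 1)) f x w) := by
  have hy := mem_extChartAt_target (I := 𝓡 (2 * n + 1)) x
  have hev : formInChart (StrictContact.pullback f α) x =ᶠ[𝓝 (extChartAt (𝓡 (2 * n + 1)) x x)]
      fun y => (α ((f ∘ (extChartAt (𝓡 (2 * n + 1)) x).symm) y)).comp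
        (push (f ∘ (extChartAt (𝓡 (2 * n + 1)) x).symm) y) := by
    filter_upwards [(isOpen_chart_target x).mem_nhds hy] with z hz
    exact formInChart_pullback hf α hz
  rw [extD_apply, curl_congr hev, curl_comp_mfderiv hα (isOpen_chart_target x)
    (hf.comp_contMDiffOn (contMDiffOn_chart_symm x)) hy]
  -- `extD` feeds vectors through the derivative of the chart φ at x, which the derivative of f ∘
  -- φ⁻¹ undoes.
  have h : ∀ u : TangentSpace (𝓡 (2 * n + 1)) x,
      (show Model n from push (f ∘ (extChartAt (𝓡 (2 * n + 1)) x).symm)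
        (extChartAt (𝓡 (2 * n + 1)) x x) (coordDeriv (extChartAt (𝓡 (2 * n + 1)) x) x u)) =
      mfderiv (𝓡 (2 * n + 1)) (𝓡 (2 * n + 1)) f x u := by
    intro u
    refine (mfderiv_comp_apply _ (hf.mdifferentiableAt (by simp))
      (mdifferentiableAt_chart_symm hy) _).trans ?_
    have h2 := mfderiv_symm_mfderiv_chart (mem_extChartAt_source (I := 𝓡 (2 * n + 1)) x) u
    refine (congrArg _ h2).trans ?_
    rw [(extChartAt (𝓡 (2 * n + 1)) x).left_inv (mem_extChartAt_source x)]
  have h0 : (f ∘ (extChartAt (𝓡 (2 * n + 1)) x).symm) (extChartAt (𝓡 (2 * n + 1)) x x) = f x := by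
    simp
  have hcongr : ∀ {a b : M} (_ : a = b) (v w : Model n), extD α a v w = extD α b v w := by
    rintro a _ rfl v w; rfl
  refine (hcongr h0 _ _).trans ?_
  exact congr (congrArg (fun u (w : Model n) => extD α (f x) u w) (h v)) (h w)

theorem volForm_pullback {f : M → M} (hf : ContMDiff (𝓡 (2 * n + 1)) (𝓡 (2 * n + 1)) ∞ f)
    {α : OneForm n M} (hα : SmoothForm α) (x : M)
    (v : Fin (2 * n + 1) → TangentSpace (𝓡 (2 * n + 1)) x) :
    volForm (StrictContact.pullback f α) x v =
      volForm α (f x) (fun i => mfderiv (𝓡 (2 * n + 1)) (𝓡 (2 * n + 1)) f x (v i)) := by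
  simp only [volForm, extD_pullback hf hα]
  rfl

theorem extD_add {α β : OneForm n M} (hα : SmoothForm α) (hβ : SmoothForm β) (x : M)
    (v w : TangentSpace (𝓡 (2 * n + 1)) x) :
    extD (α + β) x v w = extD α x v w + extD β x v w := by
  rw [extD_apply, extD_apply, extD_apply, curl_apply, curl_apply, curl_apply, formInChart_add,
    fderiv_add (hα.differentiableAt_formInChart (mem_extChartAt_target x))
      (hβ.differentiableAt_formInChart (mem_extChartAt_target x))]
  simp only [add_apply]
  ring

theorem extD_smul {α : OneForm n M} (hα : SmoothForm α) (t : ℝ) (x : M)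
    (v w : TangentSpace (𝓡 (2 * n + 1)) x) :
    extD (t • α) x v w = t * extD α x v w := by
  rw [extD_apply, extD_apply, curl_apply, curl_apply, formInChart_smul, fderiv_const_smul
    (hα.differentiableAt_formInChart (mem_extChartAt_target x))]
  simp only [smul_apply, smul_eq_mul]
  ring

end Calculus

/-! ### Nondegenerate bilinear forms and smooth solutions of linear equations -/

section Nondegenerate

theorem exists_eq_of_nondegenerate {V : Type*} [AddCommGroup V] [Module ℝ V]
    [FiniteDimensional ℝ V] (B : V →ₗ[ℝ] V →ₗ[ℝ] ℝ) (hB : ∀ v, (∀ w, B v w = 0) → v = 0)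
    (l : V →ₗ[ℝ] ℝ) : ∃ v, ∀ w, B v w = l w := by
  have hinj : Function.Injective B := by
    rw [← LinearMap.ker_eq_bot, LinearMap.ker_eq_bot']
    exact fun v hv => hB v fun w => by rw [hv]; rfl
  have hsurj := (LinearMap.injective_iff_surjective_of_finrank_eq_finrank
    (Subspace.dual_finrank_eq (K := ℝ) (V := V)).symm (f := B)).1 hinj
  obtain ⟨v, hv⟩ := hsurj l
  exact ⟨v, fun w => by rw [hv]⟩

/-- u = T⁻¹ f, and operator inversion is smooth at invertible operators. This underlies the
smoothness of R, X and β^♯ in the point, and of the Reeb vector in the deformation parameter. -/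
theorem contDiffAt_of_clm_apply_eq {G E F : Type*} [NormedAddCommGroup G] [NormedSpace ℝ G]
    [NormedAddCommGroup E] [NormedSpace ℝ E] [CompleteSpace E] [NormedAddCommGroup F]
    [NormedSpace ℝ F] {T : G → E →L[ℝ] F} {u : G → E} {f : G → F} {y : G}
    (hT : ContDiffAt ℝ ∞ T y) (hf : ContDiffAt ℝ ∞ f y)
    (he : ∀ᶠ z in 𝓝 y, ∃ e : E ≃L[ℝ] F, (e : E →L[ℝ] F) = T z)
    (hu : ∀ᶠ z in 𝓝 y, T z (u z) = f z) : ContDiffAt ℝ ∞ u y := by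
  have h1 : ContDiffAt ℝ ∞ (fun z => ContinuousLinearMap.inverse (T z)) y := by
    obtain ⟨e, he⟩ := he.self_of_nhds
    have h2 : ContDiffAt ℝ ∞ (ContinuousLinearMap.inverse : (E →L[ℝ] F) → F →L[ℝ] E) (T y) := by
      rw [← he]
      exact contDiffAt_map_inverse e
    exact h2.comp y hT
  refine (h1.clm_apply hf).congr_of_eventuallyEq ?_
  filter_upwards [he, hu] with z ⟨e, hez⟩ huz
  rw [← huz, ← hez, ContinuousLinearMap.inverse_equiv]
  simp

variable {n : ℕ} {M : Type*} [TopologicalSpace M] [ChartedSpace (Model n) M]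
  [IsManifold (𝓡 (2 * n + 1)) ∞ M]

theorem push_coordDeriv_symm {c : M} {y : Model n}
    (hy : y ∈ (extChartAt (𝓡 (2 * n + 1)) c).target)
    (v : TangentSpace (𝓡 (2 * n + 1)) ((extChartAt (𝓡 (2 * n + 1)) c).symm y)) :
    push (extChartAt (𝓡 (2 * n + 1)) c).symm y
      (coordDeriv (extChartAt (𝓡 (2 * n + 1)) c) ((extChartAt (𝓡 (2 * n + 1)) c).symm y) v) = v := by
  have h := mfderiv_symm_mfderiv_chart ((extChartAt (𝓡 (2 * n + 1)) c).map_target hy) v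
  rw [(extChartAt (𝓡 (2 * n + 1)) c).right_inv hy] at h
  exact h

/-- The solution `Y` of `B (Y, ·) = θ` is smooth when the nondegenerate bilinear form `B` and the
one-form `θ` are. -/
theorem smoothField_of_bilin
    {B : ∀ x : M, TangentSpace (𝓡 (2 * n + 1)) x →ₗ[ℝ] TangentSpace (𝓡 (2 * n + 1)) x →ₗ[ℝ] ℝ}
    (hB : ∀ (c : M) (v w : Model n), ContDiffOn ℝ ∞
      (fun y => B ((extChartAt (𝓡 (2 * n + 1)) c).symm y)
        (push (extChartAt (𝓡 (2 * n + 1)) c).symm y v)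
        (push (extChartAt (𝓡 (2 * n + 1)) c).symm y w)) (extChartAt (𝓡 (2 * n + 1)) c).target)
    (hnd : ∀ x v, (∀ w, B x v w = 0) → v = 0) {θ : OneForm n M} (hθ : SmoothForm θ)
    {Y : VField n M} (hY : ∀ x w, B x (Y x) w = θ x w) : SmoothField Y := by
  refine smoothField_of_chart fun c => ?_
  set φ := extChartAt (𝓡 (2 * n + 1)) c with hφ
  let Bc : Model n → Model n →L[ℝ] Model n →L[ℝ] ℝ := fun y =>
    LinearMap.toContinuousLinearMap ((LinearMap.toContinuousLinearMap :
      (Model n →ₗ[ℝ] ℝ) ≃ₗ[ℝ] (Model n →L[ℝ] ℝ)).toLinearMap ∘ₗ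
        ((B (φ.symm y)).compl₁₂ (push φ.symm y).toLinearMap (push φ.symm y).toLinearMap))
  have hBc : ∀ y v w, Bc y v w = B (φ.symm y) (push φ.symm y v) (push φ.symm y w) :=
    fun y v w => rfl
  have hBs : ContDiffOn ℝ ∞ Bc φ.target :=
    contDiffOn_clm_apply.2 fun v => contDiffOn_clm_apply.2 fun w => by
      simp_rw [hBc]; exact hB c v w
  have hrank : Module.finrank ℝ (Model n) = Module.finrank ℝ (Model n →L[ℝ] ℝ) :=
    (InnerProductSpace.toDual ℝ (Model n)).toLinearEquiv.finrank_eq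
  have hsol : ∀ y ∈ φ.target, Bc y (fieldInChart Y c y) = formInChart θ c y := by
    intro y hy
    ext w
    rw [hBc, fieldInChart, push_coordDeriv_symm hy, hY]
    rfl
  have hinj : ∀ y ∈ φ.target, Function.Injective (Bc y) := by
    intro y hy
    rw [injective_iff_map_eq_zero]
    intro v hv
    have h0 : push φ.symm y v = 0 := by
      refine hnd _ _ fun w => ?_
      have := hBc y v (coordDeriv φ (φ.symm y) w)
      rw [push_coordDeriv_symm hy] at this
      rw [← this, hv]; rfl
    rw [← mfderiv_chart_mfderiv_symm hy v, h0, map_zero]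
  intro y hy
  have hnhds := (isOpen_chart_target c).mem_nhds hy
  refine (contDiffAt_of_clm_apply_eq (hBs.contDiffAt hnhds)
    ((hθ.contDiffOn_formInChart c).contDiffAt hnhds) ?_ ?_).contDiffWithinAt
  · filter_upwards [hnhds] with z hz
    exact ⟨(LinearMap.linearEquivOfInjective (Bc z).toLinearMap
      (hinj z hz) hrank).toContinuousLinearEquiv, by ext v w; rfl⟩
  · filter_upwards [hnhds] with z hz using hsol z hz

end Nondegenerate

/-! ### Contact forms, Reeb fields and triad metrics -/

section ContactForms

variable {n : ℕ} {M : Type*} [TopologicalSpace M] [ChartedSpace (Model n) M]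

theorem reeb_spec_of_exists {lam : OneForm n M} {x : M}
    (h : ∃ R : TangentSpace (𝓡 (2 * n + 1)) x, lam x R = 1 ∧ ∀ w, extD lam x R w = 0) :
    lam x (reeb lam x) = 1 ∧ ∀ w, extD lam x (reeb lam x) w = 0 := by
  rw [reeb, dif_pos h]
  exact h.choose_spec

theorem reeb_spec_of_volForm_ne_zero {lam : OneForm n M} {x : M}
    {v : Fin (2 * n + 1) → TangentSpace (𝓡 (2 * n + 1)) x} (hv : volForm lam x v ≠ 0) :
    lam x (reeb lam x) = 1 ∧ ∀ w, extD lam x (reeb lam x) w = 0 := by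
  rw [volForm_eq_topForm] at hv
  exact reeb_spec_of_exists
    (exists_reeb_vector (A := extDBilin lam x) (extD_skew lam x) (finrank_tangentSpace x) hv)

theorem eq_zero_of_volForm_ne_zero {lam : OneForm n M} {x : M}
    {v : Fin (2 * n + 1) → TangentSpace (𝓡 (2 * n + 1)) x} (hv : volForm lam x v ≠ 0)
    {u : TangentSpace (𝓡 (2 * n + 1)) x} (h1 : lam x u = 0) (h2 : ∀ w, extD lam x u w = 0) :
    u = 0 := by
  rw [volForm_eq_topForm] at hv
  exact eq_zero_of_topForm_ne_zero (A := extDBilin lam x) (extD_skew lam x)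
    (finrank_tangentSpace x) hv h1 h2

/-- The bilinear form `dλ + λ ⊗ λ`. -/
def contactBilin (lam : OneForm n M) (x : M) :
    TangentSpace (𝓡 (2 * n + 1)) x →ₗ[ℝ] TangentSpace (𝓡 (2 * n + 1)) x →ₗ[ℝ] ℝ :=
  extDBilin lam x + (lam x).toLinearMap.smulRight (lam x).toLinearMap

theorem contactBilin_apply (lam : OneForm n M) (x : M) (v w : TangentSpace (𝓡 (2 * n + 1)) x) :
    contactBilin lam x v w = extD lam x v w + lam x v * lam x w := rfl

/-- Testing against R gives λ(u) = 0, after which u lies in the kernel of dλ as well. The point of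
dλ + λ ⊗ λ is to pack prescriptions of λ(u) and u ⌟ dλ into one invertible linear system. -/
theorem contactBilin_nondegenerate_of_volForm_ne_zero {lam : OneForm n M} {x : M}
    {v : Fin (2 * n + 1) → TangentSpace (𝓡 (2 * n + 1)) x} (hv : volForm lam x v ≠ 0)
    {u : TangentSpace (𝓡 (2 * n + 1)) x} (hu : ∀ w, contactBilin lam x u w = 0) : u = 0 := by
  obtain ⟨h1, h2⟩ := reeb_spec_of_volForm_ne_zero hv
  have h3 := hu (reeb lam x)
  rw [contactBilin_apply, extD_skew, h2, h1, neg_zero, zero_add, mul_one] at h3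
  refine eq_zero_of_volForm_ne_zero hv h3 fun w => ?_
  have h4 := hu w
  rwa [contactBilin_apply, h3, zero_mul, add_zero] at h4

/-- The triad metric as a bilinear form. -/
def triadBilin (lam : OneForm n M) (J : EndField n M) (x : M) :
    TangentSpace (𝓡 (2 * n + 1)) x →ₗ[ℝ] TangentSpace (𝓡 (2 * n + 1)) x →ₗ[ℝ] ℝ :=
  (extDBilin lam x).compl₂ (J x).toLinearMap + (lam x).toLinearMap.smulRight (lam x).toLinearMap

theorem triadBilin_apply (lam : OneForm n M) (J : EndField n M) (x : M)
    (v w : TangentSpace (𝓡 (2 * n + 1)) x) :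
    triadBilin lam J x v w = triadMetric lam J x v w := rfl

variable [IsManifold (𝓡 (2 * n + 1)) ∞ M] {lam : OneForm n M}

theorem IsContactForm.apply_reeb (h : IsContactForm lam) (x : M) : lam x (reeb lam x) = 1 :=
  (reeb_spec_of_volForm_ne_zero (h.nondegenerate x).choose_spec).1

theorem IsContactForm.extD_reeb (h : IsContactForm lam) (x : M)
    (w : TangentSpace (𝓡 (2 * n + 1)) x) : extD lam x (reeb lam x) w = 0 :=
  (reeb_spec_of_volForm_ne_zero (h.nondegenerate x).choose_spec).2 w

theorem IsContactForm.extD_reeb_right (h : IsContactForm lam) (x : M)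
    (w : TangentSpace (𝓡 (2 * n + 1)) x) : extD lam x w (reeb lam x) = 0 := by
  rw [extD_skew, h.extD_reeb, neg_zero]

theorem IsContactForm.eq_zero (h : IsContactForm lam) {x : M}
    {u : TangentSpace (𝓡 (2 * n + 1)) x} (h1 : lam x u = 0) (h2 : ∀ w, extD lam x u w = 0) :
    u = 0 :=
  eq_zero_of_volForm_ne_zero (h.nondegenerate x).choose_spec h1 h2

theorem IsContactForm.eq_reeb (h : IsContactForm lam) {x : M}
    {u : TangentSpace (𝓡 (2 * n + 1)) x} (h1 : lam x u = 1) (h2 : ∀ w, extD lam x u w = 0) :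
    u = reeb lam x := by
  rw [← sub_eq_zero]
  refine h.eq_zero (by rw [map_sub, h1, h.apply_reeb, sub_self]) fun w => ?_
  change extDBilin lam x (u - reeb lam x) w = 0
  simp [h2, h.extD_reeb]

theorem IsContactForm.contactBilin_nondegenerate (h : IsContactForm lam) (x : M)
    (u : TangentSpace (𝓡 (2 * n + 1)) x) (hu : ∀ w, contactBilin lam x u w = 0) : u = 0 :=
  contactBilin_nondegenerate_of_volForm_ne_zero (h.nondegenerate x).choose_spec hu

theorem contDiffOn_extD_push {α : OneForm n M} (hα : SmoothForm α) (c : M) (v w : Model n) :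
    ContDiffOn ℝ ∞ (fun y => extD α ((extChartAt (𝓡 (2 * n + 1)) c).symm y)
        (push (extChartAt (𝓡 (2 * n + 1)) c).symm y v)
        (push (extChartAt (𝓡 (2 * n + 1)) c).symm y w)) (extChartAt (𝓡 (2 * n + 1)) c).target :=
  (((contDiffOn_curl (isOpen_chart_target c) (hα.contDiffOn_formInChart c)).clm_apply
    contDiffOn_const).clm_apply contDiffOn_const).congr fun _ hy => (curl_formInChart hα hy v w).symm

theorem contDiffOn_apply_push {α : OneForm n M} (hα : SmoothForm α) (c : M) (v : Model n) :
    ContDiffOn ℝ ∞ (fun y => α ((extChartAt (𝓡 (2 * n + 1)) c).symm y)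
        (push (extChartAt (𝓡 (2 * n + 1)) c).symm y v)) (extChartAt (𝓡 (2 * n + 1)) c).target :=
  (hα.contDiffOn_formInChart c).clm_apply contDiffOn_const

theorem IsContactForm.smoothField_of_contactBilin (h : IsContactForm lam) {θ : OneForm n M}
    (hθ : SmoothForm θ) {Y : VField n M} (hY : ∀ x w, contactBilin lam x (Y x) w = θ x w) :
    SmoothField Y :=
  smoothField_of_bilin (B := contactBilin lam) (fun c v w =>
    (contDiffOn_extD_push h.smooth c v w).add
      ((contDiffOn_apply_push h.smooth c v).mul (contDiffOn_apply_push h.smooth c w)))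
    h.contactBilin_nondegenerate hθ hY

theorem IsContactForm.exists_contactBilin_eq (h : IsContactForm lam) {θ : OneForm n M}
    (hθ : SmoothForm θ) :
    ∃ Y : VField n M, SmoothField Y ∧ ∀ x w, contactBilin lam x (Y x) w = θ x w := by
  have hex : ∀ x, ∃ u, ∀ w, contactBilin lam x u w = θ x w := fun x =>
    exists_eq_of_nondegenerate (contactBilin lam x) (h.contactBilin_nondegenerate x)
      (θ x).toLinearMap
  choose Y hY using hex
  exact ⟨Y, h.smoothField_of_contactBilin hθ hY, hY⟩

theorem IsContactForm.smooth_reeb (h : IsContactForm lam) : SmoothField (reeb lam) :=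
  h.smoothField_of_contactBilin h.smooth fun x w => by
    rw [contactBilin_apply, h.extD_reeb, h.apply_reeb, zero_add, one_mul]

variable {J : EndField n M}

/-- Only the component u = v − λ(v)R in ξ contributes to dλ(v, Jv), and on ξ the form is positive
definite. -/
theorem IsContactTriad.extD_self (h : IsContactForm lam) (hJ : IsContactTriad lam J) (x : M)
    (v : TangentSpace (𝓡 (2 * n + 1)) x) :
    0 ≤ extD lam x v (J x v) ∧ (extD lam x v (J x v) = 0 → v = lam x v • StrictContact.reeb lam x) := by
  set u := v - lam x v • StrictContact.reeb lam x with hu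
  have h1 : lam x u = 0 := by simp [hu, h.apply_reeb]
  have h2 : J x v = J x u := by simp [hu, hJ.reeb]
  have h3 : extD lam x v (J x v) = extD lam x u (J x u) := by
    rw [h2, extD_skew lam x v, extD_skew lam x u]
    simp [hu, h.extD_reeb_right]
  rw [h3]
  by_cases h0 : u = 0
  · have h4 : v = lam x v • StrictContact.reeb lam x := by rwa [← sub_eq_zero]
    exact ⟨by rw [h0, map_zero, map_zero], fun _ => h4⟩
  · have := hJ.pos x u h1 h0
    exact ⟨this.le, fun h5 => absurd h5 this.ne'⟩

theorem IsContactTriad.triadBilin_nondegenerate (h : IsContactForm lam) (hJ : IsContactTriad lam J)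
    (x : M) (v : TangentSpace (𝓡 (2 * n + 1)) x) (hv : ∀ w, triadBilin lam J x v w = 0) :
    v = 0 := by
  have h1 := hv v
  rw [triadBilin_apply, triadMetric] at h1
  obtain ⟨h2, h3⟩ := hJ.extD_self h x v
  have h4 : extD lam x v (J x v) = 0 := by nlinarith [mul_self_nonneg (lam x v)]
  have h5 : lam x v = 0 := by nlinarith
  rw [h3 h4, h5, zero_smul]

theorem contDiffOn_endField (hJ : SmoothEnd J) (c : M) (w : Model n) :
    ContDiffOn ℝ ∞ (fun y => coordDeriv (extChartAt (𝓡 (2 * n + 1)) c)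
      ((extChartAt (𝓡 (2 * n + 1)) c).symm y) (J ((extChartAt (𝓡 (2 * n + 1)) c).symm y)
        (push (extChartAt (𝓡 (2 * n + 1)) c).symm y w))) (extChartAt (𝓡 (2 * n + 1)) c).target := by
  refine contDiffOn_mfderiv_apply ?_ (isOpen_extChartAt_source c) (contMDiffOn_chart c)
    (extChartAt (𝓡 (2 * n + 1)) c).mapsTo_symm
  have h1 := hJ.comp_contMDiffOn (contMDiffOn_chart_symm c)
  exact ContMDiffOn.clm_bundle_apply (F₁ := Model n) (F₂ := Model n)
    (E₁ := fun x : M => TangentSpace (𝓡 (2 * n + 1)) x)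
    (E₂ := fun x : M => TangentSpace (𝓡 (2 * n + 1)) x)
    (b := (extChartAt (𝓡 (2 * n + 1)) c).symm)
    (ϕ := fun y => J ((extChartAt (𝓡 (2 * n + 1)) c).symm y))
    (v := fun y => push (extChartAt (𝓡 (2 * n + 1)) c).symm y w) h1
    (contMDiffOn_mfderiv_const (isOpen_chart_target c) (contMDiffOn_chart_symm c) w)

theorem IsContactTriad.sharp_spec (h : IsContactForm lam) (hJ : IsContactTriad lam J)
    (β : OneForm n M) (x : M) (w : TangentSpace (𝓡 (2 * n + 1)) x) :
    triadMetric lam J x (sharp lam J β x) w = β x w := by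
  have hex : ∃ Y : TangentSpace (𝓡 (2 * n + 1)) x, ∀ w, triadMetric lam J x Y w = β x w :=
    exists_eq_of_nondegenerate (triadBilin lam J x) (hJ.triadBilin_nondegenerate h x)
      (β x).toLinearMap
  rw [sharp, dif_pos hex]
  exact hex.choose_spec w

theorem IsContactTriad.smooth_sharp (h : IsContactForm lam) (hJ : IsContactTriad lam J)
    {β : OneForm n M} (hβ : SmoothForm β) : SmoothField (sharp lam J β) := by
  refine smoothField_of_bilin (B := triadBilin lam J) (fun c v w => ?_)
    (hJ.triadBilin_nondegenerate h) hβ (hJ.sharp_spec h β)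
  refine ContDiffOn.add ?_ ((contDiffOn_apply_push h.smooth c v).mul
    (contDiffOn_apply_push h.smooth c w))
  refine (((contDiffOn_curl (isOpen_chart_target c) (h.smooth.contDiffOn_formInChart c)).clm_apply
    (contDiffOn_const (c := v))).clm_apply (contDiffOn_endField hJ.smooth c w)).congr fun y hy => ?_
  rw [curl_formInChart h.smooth hy, push_coordDeriv_symm hy]
  rfl

end ContactForms

/-! ### The measure of a contact form -/

section ContactMeasure

variable {n : ℕ} {M : Type*} [TopologicalSpace M] [ChartedSpace (Model n) M]
  [IsManifold (𝓡 (2 * n + 1)) ∞ M]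

theorem measurableSet_chart_preimage [MeasurableSpace M] [BorelSpace M] (c : M) {A : Set M}
    (hA : MeasurableSet A) :
    MeasurableSet ((extChartAt (𝓡 (2 * n + 1)) c).symm ⁻¹' A ∩
      (extChartAt (𝓡 (2 * n + 1)) c).target) := by
  have h := (contMDiffOn_chart_symm (n := n) c).continuousOn.domRestrict.measurable hA
  have := (isOpen_chart_target c).measurableSet.subtype_image h
  rwa [show (extChartAt (𝓡 (2 * n + 1)) c).target.domRestrict (extChartAt (𝓡 (2 * n + 1)) c).symm ⁻¹'
    A = Subtype.val ⁻¹' ((extChartAt (𝓡 (2 * n + 1)) c).symm ⁻¹' A) from rfl,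
    Subtype.image_preimage_coe, inter_comm] at this

variable {lam : OneForm n M}

theorem SmoothForm.continuousOn_modelVol (h : SmoothForm lam) (c : M) :
    ContinuousOn (modelVol (formInChart lam c)) (extChartAt (𝓡 (2 * n + 1)) c).target :=
  (contDiffOn_modelVol (isOpen_chart_target c) (h.contDiffOn_formInChart c)).continuousOn

theorem chartMeasure_eq [MeasurableSpace M] (h : SmoothForm lam) (c : M) :
    chartMeasure lam c = Measure.map (extChartAt (𝓡 (2 * n + 1)) c).symm
      (((volume : Measure (Model n)).restrict (extChartAt (𝓡 (2 * n + 1)) c).target).withDensity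
        fun y => ENNReal.ofReal |modelVol (formInChart lam c) y|) := by
  rw [chartMeasure]
  congr 1
  refine withDensity_congr_ae ?_
  filter_upwards [ae_restrict_mem (isOpen_chart_target c).measurableSet] with y hy
  rw [modelVol_formInChart h hy]
  rfl

theorem IsContactForm.modelVol_ne_zero (h : IsContactForm lam) {c : M} {y : Model n}
    (hy : y ∈ (extChartAt (𝓡 (2 * n + 1)) c).target) : modelVol (formInChart lam c) y ≠ 0 := by
  obtain ⟨v, hv⟩ := h.nondegenerate ((extChartAt (𝓡 (2 * n + 1)) c).symm y)
  intro h0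
  refine hv ?_
  have h1 : volForm lam ((extChartAt (𝓡 (2 * n + 1)) c).symm y) v =
      topForm (formInChart lam c y).toLinearMap (toBilin (curl (formInChart lam c) y)) fun i =>
        coordDeriv (extChartAt (𝓡 (2 * n + 1)) c) ((extChartAt (𝓡 (2 * n + 1)) c).symm y) (v i) := by
    simp only [volForm, topForm, toBilin_apply, curl_formInChart h.smooth hy,
      push_coordDeriv_symm hy, formInChart_eq, ContinuousLinearMap.coe_coe,
      ContinuousLinearMap.comp_apply]
  rw [h1, topForm_eq_det_mul _ _ (stdBasis n)]
  exact mul_eq_zero_of_right _ h0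

variable [MeasurableSpace M] [BorelSpace M]

theorem aemeasurable_chart_symm (c : M) (f : Model n → ℝ≥0∞) :
    AEMeasurable (extChartAt (𝓡 (2 * n + 1)) c).symm
      (((volume : Measure (Model n)).restrict (extChartAt (𝓡 (2 * n + 1)) c).target).withDensity f) :=
  ((contMDiffOn_chart_symm c).continuousOn.aemeasurable
    (isOpen_chart_target c).measurableSet).mono_ac (withDensity_absolutelyContinuous _ _)

theorem chartMeasure_apply (h : SmoothForm lam) (c : M) {A : Set M} (hA : MeasurableSet A) :
    chartMeasure lam c A = ∫⁻ y in (extChartAt (𝓡 (2 * n + 1)) c).symm ⁻¹' A ∩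
      (extChartAt (𝓡 (2 * n + 1)) c).target, ENNReal.ofReal |modelVol (formInChart lam c) y| := by
  rw [chartMeasure_eq h, Measure.map_apply_of_aemeasurable (aemeasurable_chart_symm c _) hA,
    withDensity_apply', Measure.restrict_restrict' (isOpen_chart_target c).measurableSet]

theorem chartMeasure_inter_source (h : SmoothForm lam) (c : M) {A : Set M} (hA : MeasurableSet A) :
    chartMeasure lam c (A ∩ (extChartAt (𝓡 (2 * n + 1)) c).source) = chartMeasure lam c A := by
  rw [chartMeasure_apply h c hA,
    chartMeasure_apply h c (hA.inter (isOpen_extChartAt_source c).measurableSet)]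
  congr 2
  ext y
  simp only [mem_inter_iff, mem_preimage]
  exact ⟨fun hy => ⟨hy.1.1, hy.2⟩,
    fun hy => ⟨⟨hy.1, (extChartAt (𝓡 (2 * n + 1)) c).map_target hy.2⟩, hy.2⟩⟩

/-- The local measures agree on overlaps. -/
theorem chartMeasure_congr (h : SmoothForm lam) (c d : M) {A : Set M} (hA : MeasurableSet A)
    (hc : A ⊆ (extChartAt (𝓡 (2 * n + 1)) c).source)
    (hd : A ⊆ (extChartAt (𝓡 (2 * n + 1)) d).source) :
    chartMeasure lam c A = chartMeasure lam d A := by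
  rw [chartMeasure_apply h c hA, chartMeasure_apply h d hA]
  set φ := extChartAt (𝓡 (2 * n + 1)) c with hφ
  set χ := extChartAt (𝓡 (2 * n + 1)) d with hχ
  set g : Model n → Model n := fun z => χ (φ.symm z) with hg
  set s := φ.symm ⁻¹' A ∩ φ.target with hs
  have hsm : MeasurableSet s := measurableSet_chart_preimage c hA
  have himg : χ.symm ⁻¹' A ∩ χ.target = g '' s := by
    ext z
    constructor
    · rintro ⟨hz, hzt⟩
      refine ⟨φ (χ.symm z), ⟨?_, φ.map_source (hc hz)⟩, ?_⟩
      · rw [mem_preimage, φ.left_inv (hc hz)]; exact hz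
      · simp only [hg]; rw [φ.left_inv (hc hz), χ.right_inv hzt]
    · rintro ⟨y, ⟨hy, hyt⟩, rfl⟩
      refine ⟨?_, χ.map_source (hd hy)⟩
      rw [mem_preimage, hg, χ.left_inv (hd hy)]; exact hy
  have hinj : InjOn g s := by
    intro y hy z hz hyz
    exact φ.symm.injOn hy.2 hz.2 (χ.injOn (hd hy.1) (hd hz.1) hyz)
  have hgd : ∀ y ∈ s, ContDiffAt ℝ ∞ g y := fun y hy =>
    contDiffAt_chart_comp (isOpen_chart_target c) (contMDiffOn_chart_symm c) hy.2 (hd hy.1)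
  -- Change of variables along the transition map `g`; its Jacobian is the factor by which the
  -- density of λ ∧ (dλ)^n transforms.
  rw [himg, lintegral_image_eq_lintegral_abs_det_fderiv_mul volume hsm
    (fun y hy => ((hgd y hy).differentiableAt (by simp)).hasFDerivAt.hasFDerivWithinAt) hinj]
  refine setLIntegral_congr_fun hsm fun y hy => ?_
  rw [← ENNReal.ofReal_mul (abs_nonneg _), ← abs_mul, ← modelVol_pullback (hgd y hy)
    (h.differentiableAt_formInChart (χ.map_source (hd hy.1)))]
  exact congrArg (fun r : ℝ => ENNReal.ofReal |r|) (modelVol_congr (eventuallyEq_formInChart_comp lam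
    (isOpen_chart_target c) (contMDiffOn_chart_symm c) hy.2 (hd hy.1)))

/-- The measure `μ_λ` restricts to the local measures. -/
theorem contactMeasure_apply [SigmaCompactSpace M] (h : SmoothForm lam) (c : M) {A : Set M}
    (hA : MeasurableSet A) (hAc : A ⊆ (extChartAt (𝓡 (2 * n + 1)) c).source) :
    contactMeasure lam A = chartMeasure lam c A := by
  obtain ⟨t, htc, htU⟩ := countable_cover_nhds_of_sigmaCompact fun x : M =>
    (isOpen_extChartAt_source (I := 𝓡 (2 * n + 1)) x).mem_nhds (mem_extChartAt_source x)
  have htn : t.Nonempty := by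
    rw [nonempty_iff_ne_empty]
    rintro rfl
    simp only [mem_empty_iff_false, iUnion_of_empty, iUnion_empty] at htU
    exact (htU.symm ▸ mem_univ c : c ∈ (∅ : Set M))
  obtain ⟨f, rfl⟩ := htc.exists_eq_range htn
  set U : ℕ → Set M := fun i => (extChartAt (𝓡 (2 * n + 1)) (f i)).source with hU
  have hUm : ∀ i, MeasurableSet (U i) := fun i => (isOpen_extChartAt_source (f i)).measurableSet
  have hD : ∀ i, MeasurableSet (disjointed U i) := fun i => MeasurableSet.disjointed hUm i
  have hDU : ⋃ i, disjointed U i = univ := by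
    rw [iUnion_disjointed, ← htU, biUnion_range]
  -- Glue the local measures over a countable disjoint partition subordinate to chart domains. By
  -- consistency on overlaps ν restricts to every local measure, so it dominates their supremum; on
  -- a chart domain it equals one of them, hence is also dominated by the supremum.
  let ν : Measure M := Measure.sum fun i => (chartMeasure lam (f i)).restrict (disjointed U i)
  have hν : ∀ (d : M) (B : Set M), MeasurableSet B → B ⊆ (extChartAt (𝓡 (2 * n + 1)) d).source →
      ν B = chartMeasure lam d B := by
    intro d B hB hBd
    have h1 : B = ⋃ i, B ∩ disjointed U i := by rw [← inter_iUnion, hDU, inter_univ]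
    rw [Measure.sum_apply _ hB]
    conv_rhs => rw [h1]
    rw [measure_iUnion (fun i j hij => ((disjoint_disjointed U) hij).mono inter_subset_right
      inter_subset_right) fun i => hB.inter (hD i)]
    congr 1
    funext i
    rw [Measure.restrict_apply hB]
    exact chartMeasure_congr h _ _ (hB.inter (hD i))
      (inter_subset_right.trans (disjointed_subset U i)) (inter_subset_left.trans hBd)
  refine le_antisymm ?_ (Measure.le_iff'.1 (le_iSup (chartMeasure lam) c) A)
  rw [← hν c A hA hAc]
  refine Measure.le_iff'.1 (iSup_le fun d => Measure.le_iff.2 fun B hB => ?_) A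
  rw [← chartMeasure_inter_source h d hB, ← hν d _ (hB.inter
    (isOpen_extChartAt_source d).measurableSet) inter_subset_right]
  exact measure_mono inter_subset_left

theorem contactMeasure_restrict_source [SigmaCompactSpace M] (h : SmoothForm lam) (c : M) :
    (contactMeasure lam).restrict (extChartAt (𝓡 (2 * n + 1)) c).source = chartMeasure lam c := by
  ext A hA
  rw [Measure.restrict_apply hA, contactMeasure_apply h c
    (hA.inter (isOpen_extChartAt_source c).measurableSet) inter_subset_right,
    chartMeasure_inter_source h c hA]

theorem integral_contactMeasure_eq [SigmaCompactSpace M] (h : SmoothForm lam) (c : M) {u : M → ℝ}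
    (hu : Continuous u) (huc : ∀ x ∉ (extChartAt (𝓡 (2 * n + 1)) c).source, u x = 0) :
    ∫ x, u x ∂(contactMeasure lam) = ∫ y in (extChartAt (𝓡 (2 * n + 1)) c).target,
      |modelVol (formInChart lam c) y| * u ((extChartAt (𝓡 (2 * n + 1)) c).symm y) := by
  rw [← setIntegral_eq_integral_of_forall_compl_eq_zero huc, contactMeasure_restrict_source h,
    chartMeasure_eq h, integral_map (aemeasurable_chart_symm c _) hu.aestronglyMeasurable]
  have hm : AEMeasurable (fun y => Real.toNNReal |modelVol (formInChart lam c) y|)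
      ((volume : Measure (Model n)).restrict (extChartAt (𝓡 (2 * n + 1)) c).target) :=
    (continuous_real_toNNReal.comp_continuousOn
      (h.continuousOn_modelVol c).abs).aemeasurable (isOpen_chart_target c).measurableSet
  refine (integral_withDensity_eq_integral_smul₀ hm _).trans ?_
  refine integral_congr_ae (.of_forall fun y => ?_)
  simp [NNReal.smul_def]

/-- The density has no zeros, so a null open set would be Lebesgue null in a chart. -/
theorem IsContactForm.isOpenPosMeasure (h : IsContactForm lam) :
    (contactMeasure lam).IsOpenPosMeasure := by
  refine ⟨fun U hU hne h0 => ?_⟩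
  obtain ⟨x, hx⟩ := hne
  have h1 : chartMeasure lam x U = 0 :=
    le_antisymm (h0 ▸ Measure.le_iff'.1 (le_iSup (chartMeasure lam) x) U) zero_le
  rw [chartMeasure_apply h.smooth x hU.measurableSet] at h1
  set φ := extChartAt (𝓡 (2 * n + 1)) x
  have hs : IsOpen (φ.symm ⁻¹' U ∩ φ.target) := by
    rw [inter_comm]
    exact (contMDiffOn_chart_symm x).continuousOn.isOpen_inter_preimage (isOpen_chart_target x) hU
  have hm : AEMeasurable (fun y => ENNReal.ofReal |modelVol (formInChart lam x) y|)
      ((volume : Measure (Model n)).restrict (φ.symm ⁻¹' U ∩ φ.target)) :=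
    (ENNReal.continuous_ofReal.comp_continuousOn ((h.smooth.continuousOn_modelVol x).mono
      inter_subset_right).abs).aemeasurable hs.measurableSet
  rw [lintegral_eq_zero_iff' hm, Filter.EventuallyEq, ae_restrict_iff' hs.measurableSet] at h1
  have h2 : volume (φ.symm ⁻¹' U ∩ φ.target) = 0 := by
    refine measure_mono_null (fun y hy => ?_) (ae_iff.1 h1)
    simp only [mem_ofPred_eq, not_forall]
    refine ⟨hy, fun h3 => ?_⟩
    have : |modelVol (formInChart lam x) y| ≤ 0 := ENNReal.ofReal_eq_zero.1 h3
    exact h.modelVol_ne_zero hy.2 (abs_nonpos_iff.1 this)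
  refine (hs.measure_pos volume ⟨φ x, ?_, mem_extChartAt_target x⟩).ne' h2
  rw [mem_preimage, φ.left_inv (mem_extChartAt_source x)]
  exact hx

end ContactMeasure

/-! ### Derivatives along the Reeb field integrate to zero -/

section Stokes

variable {n : ℕ} {M : Type*} [TopologicalSpace M] [ChartedSpace (Model n) M]

/-- The differential of a function. -/
def dForm (f : M → ℝ) : OneForm n M := fun x => mvfderiv (𝓡 (2 * n + 1)) f x

theorem dirDeriv_eq (X : VField n M) (f : M → ℝ) (x : M) : dirDeriv X f x = dForm f x (X x) := rfl

theorem dirDeriv_add {X : VField n M} {f g : M → ℝ}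
    (hf : ContMDiff (𝓡 (2 * n + 1)) 𝓘(ℝ, ℝ) ∞ f) (hg : ContMDiff (𝓡 (2 * n + 1)) 𝓘(ℝ, ℝ) ∞ g)
    (x : M) : dirDeriv X (fun x => f x + g x) x = dirDeriv X f x + dirDeriv X g x := by
  rw [dirDeriv, mvfderiv_fun_add (hf.mdifferentiableAt (by simp)) (hg.mdifferentiableAt (by simp))]
  rfl

theorem dirDeriv_mul {X : VField n M} {f g : M → ℝ}
    (hf : ContMDiff (𝓡 (2 * n + 1)) 𝓘(ℝ, ℝ) ∞ f) (hg : ContMDiff (𝓡 (2 * n + 1)) 𝓘(ℝ, ℝ) ∞ g)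
    (x : M) :
    dirDeriv X (fun x => f x * g x) x = f x * dirDeriv X g x + g x * dirDeriv X f x := by
  rw [dirDeriv, mvfderiv_fun_mul (hf.mdifferentiableAt (by simp)) (hg.mdifferentiableAt (by simp))]
  rfl

theorem dirDeriv_sum {ι : Type*} (s : Finset ι) {X : VField n M} {f : ι → M → ℝ}
    (hf : ∀ i, ContMDiff (𝓡 (2 * n + 1)) 𝓘(ℝ, ℝ) ∞ (f i)) (x : M) :
    dirDeriv X (fun x => ∑ i ∈ s, f i x) x = ∑ i ∈ s, dirDeriv X (f i) x := by
  classical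
  induction s using Finset.induction_on with
  | empty =>
    simp only [Finset.sum_empty]
    rw [dirDeriv, mvfderiv_const]
    rfl
  | insert a s ha ih =>
    simp only [Finset.sum_insert ha]
    rw [dirDeriv_add (hf a) (contMDiff_finsetSum fun i _ => hf i), ih]

theorem dirDeriv_eq_zero_of_notMem_tsupport (X : VField n M) {f : M → ℝ} {x : M}
    (hx : x ∉ tsupport f) : dirDeriv X f x = 0 := by
  have h : f =ᶠ[𝓝 x] fun _ => 0 := notMem_tsupport_iff_eventuallyEq.1 hx
  have h2 : mvfderiv (𝓡 (2 * n + 1)) f x = 0 := by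
    rw [mvfderiv, h.mfderiv_eq, mfderiv_const]
    exact ContinuousLinearMap.comp_zero _
  rw [dirDeriv, h2]
  rfl

variable [IsManifold (𝓡 (2 * n + 1)) ∞ M]

theorem formInChart_dForm {f : M → ℝ} (hf : ContMDiff (𝓡 (2 * n + 1)) 𝓘(ℝ, ℝ) ∞ f) {c : M}
    {y : Model n} (hy : y ∈ (extChartAt (𝓡 (2 * n + 1)) c).target) :
    formInChart (dForm f) c y =
      fderiv ℝ (fun y => f ((extChartAt (𝓡 (2 * n + 1)) c).symm y)) y := by
  ext v
  have := mfderiv_comp_apply y (hf.mdifferentiableAt (by simp)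
    (x := (extChartAt (𝓡 (2 * n + 1)) c).symm y)) (mdifferentiableAt_chart_symm hy) v
  rw [mfderiv_eq_fderiv] at this
  exact this.symm

theorem smoothForm_dForm {f : M → ℝ} (hf : ContMDiff (𝓡 (2 * n + 1)) 𝓘(ℝ, ℝ) ∞ f) :
    SmoothForm (dForm f : OneForm n M) :=
  smoothForm_of_chart fun c =>
    ((contDiffOn_chart_symm hf c).fderiv_of_isOpen (isOpen_chart_target c) (by simp)).congr
      fun _ hy => formInChart_dForm hf hy

theorem contMDiff_dirDeriv {X : VField n M} (hX : SmoothField X) {f : M → ℝ}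
    (hf : ContMDiff (𝓡 (2 * n + 1)) 𝓘(ℝ, ℝ) ∞ f) :
    ContMDiff (𝓡 (2 * n + 1)) 𝓘(ℝ, ℝ) ∞ (dirDeriv X f) :=
  (smoothForm_dForm hf).contMDiff_apply hX

variable {lam : OneForm n M} [MeasurableSpace M] [BorelSpace M] [CompactSpace M]

theorem IsContactForm.integral_dirDeriv_reeb_of_tsupport (h : IsContactForm lam) (c : M)
    {f : M → ℝ} (hf : ContMDiff (𝓡 (2 * n + 1)) 𝓘(ℝ, ℝ) ∞ f)
    (hfc : tsupport f ⊆ (extChartAt (𝓡 (2 * n + 1)) c).source) :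
    ∫ x, dirDeriv (reeb lam) f x ∂(contactMeasure lam) = 0 := by
  rw [integral_contactMeasure_eq h.smooth c (contMDiff_dirDeriv h.smooth_reeb hf).continuous
    fun x hx => dirDeriv_eq_zero_of_notMem_tsupport _ fun h => hx (hfc h)]
  set φ := extChartAt (𝓡 (2 * n + 1)) c with hφ
  have hUo : IsOpen φ.target := isOpen_chart_target c
  -- Outside the target φ⁻¹ takes meaningless values, hence the cut-off; it stays smooth because the
  -- support of `f` has compact image inside the target.
  set g : Model n → ℝ := φ.target.indicator fun y => f (φ.symm y) with hg
  have hgU : ∀ y ∈ φ.target, g =ᶠ[𝓝 y] fun y => f (φ.symm y) := fun y hy => by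
    filter_upwards [hUo.mem_nhds hy] with z hz using indicator_of_mem hz _
  have hK : IsCompact (φ '' tsupport f) := (isClosed_tsupport f).isCompact.image_of_continuousOn
    ((contMDiffOn_chart c).continuousOn.mono hfc)
  have hKU : φ '' tsupport f ⊆ φ.target := by
    rintro _ ⟨x, hx, rfl⟩
    exact φ.map_source (hfc hx)
  have hgK : Function.support g ⊆ φ '' tsupport f := by
    intro y hy
    have hyt : y ∈ φ.target := by
      by_contra hyt
      exact hy (indicator_of_notMem hyt _)
    rw [Function.mem_support, hg, indicator_of_mem hyt] at hy
    exact ⟨φ.symm y, subset_tsupport _ hy, φ.right_inv hyt⟩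
  have hgt : tsupport g ⊆ φ '' tsupport f := closure_minimal hgK hK.isClosed
  have hgc : HasCompactSupport g := hK.of_isClosed_subset (isClosed_tsupport g) hgt
  have hgs : ContDiff ℝ ∞ g := by
    refine contDiff_iff_contDiffAt.2 fun y => ?_
    by_cases hy : y ∈ φ.target
    · exact (((contDiffOn_chart_symm hf c).contDiffAt (hUo.mem_nhds hy))).congr_of_eventuallyEq
        (hgU y hy)
    · have : g =ᶠ[𝓝 y] fun _ => 0 :=
        notMem_tsupport_iff_eventuallyEq.1 fun h => hy (hKU (hgt h))
      exact (contDiffAt_const (c := (0 : ℝ))).congr_of_eventuallyEq this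
  have hmain := integral_sign_mul_topForm_fderiv_eq_zero hUo (h.smooth.contDiffOn_formInChart c)
    (fun y hy => h.modelVol_ne_zero hy) hgs hgc (hgt.trans hKU)
  have hzero : ∀ y ∉ φ.target, (SignType.sign (modelVol (formInChart lam c) y) : ℝ) *
      topForm (fderiv ℝ g y).toLinearMap (toBilin (curl (formInChart lam c) y)) (stdBasis n) = 0 := by
    intro y hy
    have : fderiv ℝ g y = 0 := by
      have h1 : g =ᶠ[𝓝 y] fun _ => 0 :=
        notMem_tsupport_iff_eventuallyEq.1 fun h => hy (hKU (hgt h))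
      rw [h1.fderiv_eq]; simp
    rw [this]
    simp [topForm]
  rw [← setIntegral_eq_integral_of_forall_compl_eq_zero hzero] at hmain
  rw [← hmain]
  refine setIntegral_congr_fun hUo.measurableSet fun y hy => ?_
  -- The chart expression of R is the kernel vector in `topForm_eq_apply_mul`, which turns R[f]
  -- times the density into df ∧ (dλ)^n.
  set r : Model n := fieldInChart (reeb lam) c y with hr
  have hpr : push φ.symm y r = reeb lam (φ.symm y) := push_coordDeriv_symm hy _
  have h1 : formInChart lam c y r = 1 := by
    rw [formInChart_eq, ContinuousLinearMap.comp_apply, hpr, h.apply_reeb]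
  have h2 : ∀ w, curl (formInChart lam c) y r w = 0 := fun w => by
    rw [curl_formInChart h.smooth hy, hpr, h.extD_reeb]
  have h3 : dirDeriv (reeb lam) f (φ.symm y) = fderiv ℝ g y r := by
    rw [(hgU y hy).fderiv_eq, ← formInChart_dForm hf hy, formInChart_eq,
      ContinuousLinearMap.comp_apply, hpr, dirDeriv_eq]
  have h4 := topForm_eq_apply_mul (a := (fderiv ℝ g y).toLinearMap)
    (l := (formInChart lam c y).toLinearMap) (A := toBilin (curl (formInChart lam c) y))
    (curl_skew _ y) (finrank_euclideanSpace_fin (𝕜 := ℝ) (n := 2 * n + 1)) h1 h2 (stdBasis n)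
  have h5 : |modelVol (formInChart lam c) y| =
      (SignType.sign (modelVol (formInChart lam c) y) : ℝ) * modelVol (formInChart lam c) y :=
    (sign_mul_self _).symm
  simp only [h3, h4, h5]
  change _ = _ * (fderiv ℝ g y r * modelVol (formInChart lam c) y)
  ring

variable [T2Space M]

theorem IsContactForm.integral_dirDeriv_reeb (h : IsContactForm lam)
    [IsFiniteMeasure (contactMeasure lam)] {f : M → ℝ}
    (hf : ContMDiff (𝓡 (2 * n + 1)) 𝓘(ℝ, ℝ) ∞ f) :
    ∫ x, dirDeriv (reeb lam) f x ∂(contactMeasure lam) = 0 := by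
  obtain ⟨t, ht⟩ := isCompact_univ.elim_finite_subcover
    (fun c : M => (extChartAt (𝓡 (2 * n + 1)) c).source) (fun c => isOpen_extChartAt_source c)
    fun x _ => mem_iUnion.2 ⟨x, mem_extChartAt_source x⟩
  obtain ⟨χ, hχ⟩ := SmoothPartitionOfUnity.exists_isSubordinate (𝓡 (2 * n + 1))
    (isClosed_univ (X := M)) (fun c : t => (extChartAt (𝓡 (2 * n + 1)) c.1).source)
    (fun c => isOpen_extChartAt_source c.1) (fun x hx => by
      obtain ⟨c, hc⟩ := mem_iUnion.1 (ht hx)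
      obtain ⟨hct, hc⟩ := mem_iUnion.1 hc
      exact mem_iUnion.2 ⟨⟨c, hct⟩, hc⟩)
  have hs : ∀ c : t, ContMDiff (𝓡 (2 * n + 1)) 𝓘(ℝ, ℝ) ∞ (fun x => χ c x * f x) := fun c =>
    (χ c).contMDiff.mul hf
  have hsum : f = fun x => ∑ c : t, χ c x * f x := by
    funext x
    have := χ.sum_eq_one (mem_univ x)
    rw [finsum_eq_sum_of_fintype] at this
    rw [← Finset.sum_mul, this, one_mul]
  rw [hsum]
  simp_rw [dirDeriv_sum Finset.univ hs]
  rw [integral_finsetSum]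
  · refine Finset.sum_eq_zero fun c _ => h.integral_dirDeriv_reeb_of_tsupport c.1 (hs c) ?_
    exact (tsupport_mul_subset_left).trans (hχ c)
  · intro c _
    exact (contMDiff_dirDeriv h.smooth_reeb (hs c)).continuous.integrable_of_hasCompactSupport
      (HasCompactSupport.of_compactSpace _)

end Stokes

/-! ### The linearization of `Φ` and of the volume form -/

section ReebVariation

/-- The solution `R t` of `(l + t a) (R t) = 1`, `R t ⌟ (A + t B) = 0` is differentiable. -/
theorem hasDerivAt_reeb_vector {V : Type*} [NormedAddCommGroup V] [NormedSpace ℝ V]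
    [FiniteDimensional ℝ V] {l a : V →L[ℝ] ℝ} {A B : V →L[ℝ] V →L[ℝ] ℝ} {R : ℝ → V}
    (hnd : ∀ v, (∀ w, A v w + l v * l w = 0) → v = 0)
    (hR : ∀ᶠ t in 𝓝 (0 : ℝ), l (R t) + t * a (R t) = 1 ∧ ∀ w, A (R t) w + t * B (R t) w = 0) :
    ∃ R', HasDerivAt R R' 0 ∧ a (R 0) + l R' = 0 := by
  -- Both defining equations of R t combine into S(t)(R t) = l + t a, a linear system that is
  -- invertible at t = 0 and hence nearby.
  let S : ℝ → V →L[ℝ] V →L[ℝ] ℝ := fun t => A + t • B + (l + t • a).smulRight (l + t • a)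
  have hS : ContDiff ℝ ∞ S := by
    refine contDiff_clm_apply_iff.2 fun v => contDiff_clm_apply_iff.2 fun w => ?_
    simp only [S, add_apply, smul_apply, ContinuousLinearMap.smulRight_apply, smul_eq_mul]
    fun_prop
  have hinj : Function.Injective (S 0) := by
    rw [injective_iff_map_eq_zero]
    intro v hv
    refine hnd v fun w => ?_
    have := congrArg (fun f : V →L[ℝ] ℝ => f w) hv
    simpa [S] using this
  have hrank : Module.finrank ℝ V = Module.finrank ℝ (V →L[ℝ] ℝ) := by
    rw [← LinearEquiv.finrank_eq (LinearMap.toContinuousLinearMap (𝕜 := ℝ) (E := V) (F' := ℝ)),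
      ← Subspace.dual_finrank_eq (K := ℝ) (V := V)]
  let e : V ≃L[ℝ] (V →L[ℝ] ℝ) :=
    (LinearMap.linearEquivOfInjective (S 0).toLinearMap hinj hrank).toContinuousLinearEquiv
  have he : (e : V →L[ℝ] (V →L[ℝ] ℝ)) = S 0 := by ext v w; rfl
  have hcomplete : CompleteSpace V := FiniteDimensional.complete ℝ V
  have hd : ContDiffAt ℝ ∞ R 0 := by
    refine contDiffAt_of_clm_apply_eq (f := fun t : ℝ => l + t • a) hS.contDiffAt
      (contDiff_const.add (contDiff_id.smul contDiff_const)).contDiffAt ?_ ?_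
    · refine hS.continuous.continuousAt.eventually (p := fun T => ∃ e : V ≃L[ℝ] (V →L[ℝ] ℝ),
        (e : V →L[ℝ] (V →L[ℝ] ℝ)) = T) ?_
      rw [← he]
      exact ContinuousLinearEquiv.nhds e
    · filter_upwards [hR] with t ⟨h1, h2⟩
      ext w
      have h3 := h2 w
      have h1' : l (R t) + t * a (R t) = 1 := h1
      simp only [S, add_apply, smul_apply, ContinuousLinearMap.smulRight_apply, smul_eq_mul, h1', h3]
      ring
  have hd' := (hd.differentiableAt (by simp)).hasDerivAt
  refine ⟨deriv R 0, hd', ?_⟩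
  -- Differentiate the normalization (l + t a)(R t) = 1. The resulting value of l(R') is all that
  -- the derivative of Φ needs.
  have h1 : HasDerivAt (fun t : ℝ => l (R t) + t * a (R t))
      (l (deriv R 0) + (1 * a (R 0) + 0 * a (deriv R 0))) 0 :=
    (l.hasFDerivAt.comp_hasDerivAt 0 hd').add
      ((hasDerivAt_id (0 : ℝ)).mul (a.hasFDerivAt.comp_hasDerivAt 0 hd'))
  have h2 : HasDerivAt (fun t : ℝ => l (R t) + t * a (R t)) 0 0 :=
    (hasDerivAt_const (0 : ℝ) (1 : ℝ)).congr_of_eventuallyEq (hR.mono fun t ht => ht.1)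
  have := h1.unique h2
  linarith

end ReebVariation

/-! ### First variations of the volume form, the Reeb vector and Φ -/

section Linearization

variable {n : ℕ} {M : Type*} [TopologicalSpace M] [ChartedSpace (Model n) M]

/-- The bilinear form `extD α x` on the model space. -/
def extDModel (α : OneForm n M) (x : M) : Model n →L[ℝ] Model n →L[ℝ] ℝ :=
  LinearMap.toContinuousLinearMap ((LinearMap.toContinuousLinearMap :
    (Model n →ₗ[ℝ] ℝ) ≃ₗ[ℝ] (Model n →L[ℝ] ℝ)).toLinearMap ∘ₗ
      (show Model n →ₗ[ℝ] Model n →ₗ[ℝ] ℝ from extDBilin α x))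

/-- The derivative of `t ↦ (l + t a) ∧ (A + t B)^n` at `t = 0`. -/
def topVariation {V : Type*} (l a : V → ℝ) (A B : V → V → ℝ) (v : Fin (2 * n + 1) → V) : ℝ :=
  (1 / 2 : ℝ) ^ n * ∑ σ : Equiv.Perm (Fin (2 * n + 1)), ((Equiv.Perm.sign σ : ℤ) : ℝ) *
    (a (v (σ 0)) * (∏ i : Fin n, A (v (σ ⟨2 * i.1 + 1, by omega⟩)) (v (σ ⟨2 * i.1 + 2, by omega⟩))) +
      l (v (σ 0)) * ∑ k : Fin n, (∏ i ∈ Finset.univ.erase k,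
        A (v (σ ⟨2 * i.1 + 1, by omega⟩)) (v (σ ⟨2 * i.1 + 2, by omega⟩))) *
          B (v (σ ⟨2 * k.1 + 1, by omega⟩)) (v (σ ⟨2 * k.1 + 2, by omega⟩)))

theorem topVariation_add {V : Type*} (l a a' : V → ℝ) (A B B' : V → V → ℝ)
    (v : Fin (2 * n + 1) → V) :
    topVariation l (fun x => a x + a' x) A (fun x y => B x y + B' x y) v =
      topVariation l a A B v + topVariation l a' A B' v := by
  simp only [topVariation]
  rw [← mul_add, ← Finset.sum_add_distrib]
  congr 1
  refine Finset.sum_congr rfl fun σ _ => ?_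
  simp only [mul_add, add_mul, Finset.sum_add_distrib]
  ring

variable [IsManifold (𝓡 (2 * n + 1)) ∞ M] {lam α β : OneForm n M}

theorem extD_add_smul (hl : SmoothForm lam) (hα : SmoothForm α) (t : ℝ) (x : M)
    (v w : TangentSpace (𝓡 (2 * n + 1)) x) :
    extD (lam + t • α) x v w = extD lam x v w + t * extD α x v w := by
  rw [extD_add hl (hα.const_smul t), extD_smul hα]

theorem hasDerivAt_volForm (hl : SmoothForm lam) (hα : SmoothForm α) (x : M)
    (v : Fin (2 * n + 1) → TangentSpace (𝓡 (2 * n + 1)) x) :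
    HasDerivAt (fun t : ℝ => volForm (lam + t • α) x v) (topVariation (lam x) (α x)
      (fun v w => extD lam x v w) (fun v w => extD α x v w) v) 0 := by
  have hlin : ∀ b c : ℝ, HasDerivAt (fun t : ℝ => b + t * c) c 0 := fun b c => by
    simpa using ((hasDerivAt_id (0 : ℝ)).mul_const c).const_add b
  simp only [volForm, extD_add_smul hl hα, topVariation]
  refine HasDerivAt.const_mul _ (HasDerivAt.fun_sum fun σ _ => HasDerivAt.const_mul _ ?_)
  have h1 := HasDerivAt.fun_finsetProd (u := Finset.univ) (x := (0 : ℝ)) fun (i : Fin n) _ =>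
    hlin (extD lam x (v (σ ⟨2 * i.1 + 1, by omega⟩)) (v (σ ⟨2 * i.1 + 2, by omega⟩)))
      (extD α x (v (σ ⟨2 * i.1 + 1, by omega⟩)) (v (σ ⟨2 * i.1 + 2, by omega⟩)))
  have h2 := (hlin (lam x (v (σ 0))) (α x (v (σ 0)))).mul h1
  simp only [zero_mul, add_zero, smul_eq_mul] at h2
  exact h2

theorem volVariation_eq (hl : SmoothForm lam) (hα : SmoothForm α) (x : M)
    (v : Fin (2 * n + 1) → TangentSpace (𝓡 (2 * n + 1)) x) :
    volVariation lam α x v = topVariation (lam x) (α x)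
      (fun v w => extD lam x v w) (fun v w => extD α x v w) v :=
  (hasDerivAt_volForm hl hα x v).deriv

theorem volVariation_add (hl : SmoothForm lam) (hα : SmoothForm α) (hβ : SmoothForm β) (x : M)
    (v : Fin (2 * n + 1) → TangentSpace (𝓡 (2 * n + 1)) x) :
    volVariation lam (α + β) x v = volVariation lam α x v + volVariation lam β x v := by
  rw [volVariation_eq hl hα, volVariation_eq hl hβ, volVariation_eq hl (hα.add hβ),
    ← topVariation_add]
  simp only [extD_add hα hβ]
  rfl

theorem volVariation_pullback {f : M → M} (hf : ContMDiff (𝓡 (2 * n + 1)) (𝓡 (2 * n + 1)) ∞ f)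
    (hl : SmoothForm lam) (hα : SmoothForm α) (x : M)
    (v : Fin (2 * n + 1) → TangentSpace (𝓡 (2 * n + 1)) x) :
    volVariation (pullback f lam) (pullback f α) x v =
      volVariation lam α (f x) (fun i => mfderiv (𝓡 (2 * n + 1)) (𝓡 (2 * n + 1)) f x (v i)) := by
  rw [volVariation, volVariation]
  congr 1
  funext t
  rw [← volForm_pullback hf (hl.add (hα.const_smul t))]
  rfl

/-- At the fixed point `x` nondegeneracy persists for small t, so `reeb (lam + t • α) x` is the
genuine solution there and not its default value 0. No uniformity in `x` is required. -/
theorem IsContactForm.exists_hasDerivAt_reeb (h : IsContactForm lam) (hα : SmoothForm α) (x : M) :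
    ∃ R' : Model n, HasDerivAt (fun t : ℝ => (reeb (lam + t • α) x : Model n)) R' 0 ∧
      α x (reeb lam x) + lam x R' = 0 := by
  have h0 : lam + (0 : ℝ) • α = lam := by rw [zero_smul ℝ α, add_zero]
  obtain ⟨v, hv⟩ := h.nondegenerate x
  have hev : ∀ᶠ t : ℝ in 𝓝 0, volForm (lam + t • α) x v ≠ 0 := by
    refine (hasDerivAt_volForm h.smooth hα x v).continuousAt.eventually_ne ?_
    rwa [h0]
  obtain ⟨R', h1, h2⟩ := hasDerivAt_reeb_vector (V := Model n) (l := lam x) (a := α x)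
    (A := extDModel lam x) (B := extDModel α x)
    (R := fun t : ℝ => reeb (lam + t • α) x) (h.contactBilin_nondegenerate x)
    (hev.mono fun t ht => by
      obtain ⟨h1, h2⟩ := reeb_spec_of_volForm_ne_zero ht
      refine ⟨h1, fun w => ?_⟩
      exact (extD_add_smul h.smooth hα t x _ w).symm.trans (h2 w))
  refine ⟨R', h1, ?_⟩
  rw [h0] at h2
  exact h2

/-- The derivative of `Φ` in the direction `α` at a strict contact pair is `(ψ^*α - α)^π`. -/
theorem IsContactForm.deriv_Phi (h : IsContactForm lam) (hα : SmoothForm α) {ψ : M → M}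
    (hψ : pullback ψ lam = lam) (x : M) (v : TangentSpace (𝓡 (2 * n + 1)) x) :
    deriv (fun t : ℝ => Phi (lam + t • α) ψ x v) 0 = proj lam (pullback ψ α - α) x v := by
  have h0 : lam + (0 : ℝ) • α = lam := by rw [zero_smul ℝ α, add_zero]
  obtain ⟨R', hR, hR'⟩ := h.exists_hasDerivAt_reeb hα x
  have hPhi : ∀ t : ℝ, Phi (lam + t • α) ψ x v = (lam x v + t * pullback ψ α x v) -
      (lam x (reeb (lam + t • α) x) + t * pullback ψ α x (reeb (lam + t • α) x)) *
        (lam x v + t * α x v) := by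
    intro t
    have hp : pullback ψ (lam + t • α) = lam + t • pullback ψ α := by
      conv_rhs => rw [← hψ]
      rfl
    rw [Phi, proj, hp]
    rfl
  have hlin : ∀ b c : ℝ, HasDerivAt (fun t : ℝ => b + t * c) c 0 := fun b c => by
    simpa using ((hasDerivAt_id (0 : ℝ)).mul_const c).const_add b
  have hform : ∀ θ : OneForm n M, HasDerivAt (fun t : ℝ => θ x (reeb (lam + t • α) x)) (θ x R') 0 :=
    fun θ => (show Model n →L[ℝ] ℝ from θ x).hasFDerivAt.comp_hasDerivAt 0 hR
  have hd := (hlin (lam x v) (pullback ψ α x v)).sub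
    (((hform lam).add ((hasDerivAt_id (0 : ℝ)).mul (hform (pullback ψ α)))).mul
      (hlin (lam x v) (α x v)))
  simp_rw [hPhi]
  refine hd.deriv.trans ?_
  simp only [id, h0, zero_mul, add_zero, one_mul, h.apply_reeb, proj, Pi.add_apply, Pi.mul_apply]
  change _ = (pullback ψ α x v - α x v) -
    (pullback ψ α x (reeb lam x) - α x (reeb lam x)) * lam x v
  -- λ(R') = −α(R) turns the variation of the Reeb vector into the term missing from (ψ^*α − α)^π.
  rw [← eq_neg_iff_add_eq_zero] at hR'
  rw [hR']
  ring

/-- The pairs with `ψ^*(α + L_X λ) = α` are tangent to the space of strict contact pairs. -/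
theorem IsContactForm.mem_tangentStrict [MeasurableSpace M] (h : IsContactForm lam) {ψ : M → M}
    (hψs : ContMDiff (𝓡 (2 * n + 1)) (𝓡 (2 * n + 1)) ∞ ψ) (hψ : pullback ψ lam = lam)
    (hα : α ∈ TangentForms lam) {X : VField n M} (hX : SmoothField X)
    (hL : SmoothForm (lieForm X lam)) (hαX : pullback ψ (α + lieForm X lam) = α) :
    (α, X) ∈ TangentStrict lam ψ := by
  refine ⟨⟨hα, hX, fun x v => ?_⟩, fun x v => ?_⟩
  -- Naturality: ψ^* of the variation of μ_λ along α + L_X λ is the variation of μ_{ψ^*λ} = μ_λ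
  -- along ψ^*(α + L_X λ) = α.
  · have h1 := volVariation_pullback hψs h.smooth (hα.1.add hL) x v
    rw [hψ, hαX, volVariation_add h.smooth hα.1 hL] at h1
    exact h1.symm
  · rw [dPhi, h.deriv_Phi hα.1 hψ]
    have h1 : ∀ u, pullback ψ (lieForm X lam) x u = α x u - pullback ψ α x u := by
      intro u
      rw [eq_sub_iff_add_eq, add_comm]
      exact congrArg (fun θ : OneForm n M => θ x u) hαX
    simp only [proj]
    change (pullback ψ α x v - α x v) -
      (pullback ψ α x (reeb lam x) - α x (reeb lam x)) * lam x v +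
      (pullback ψ (lieForm X lam) x v -
        pullback ψ (lieForm X lam) x (reeb lam x) * lam x v) = 0
    rw [h1, h1]
    ring

end Linearization

/-! ### Tangent vectors of the space of strict contact pairs -/

section Construction

variable {n : ℕ} {M : Type*} [TopologicalSpace M] [ChartedSpace (Model n) M]

theorem pullback_pullback {f g : M → M}
    (hf : MDifferentiable (𝓡 (2 * n + 1)) (𝓡 (2 * n + 1)) f)
    (hg : MDifferentiable (𝓡 (2 * n + 1)) (𝓡 (2 * n + 1)) g) (α : OneForm n M) :
    pullback f (pullback g α) = pullback (g ∘ f) α := by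
  funext x
  ext v
  exact congrArg (α (g (f x))) (mfderiv_comp_apply x (hg (f x)) (hf x) v).symm

theorem pullback_id (α : OneForm n M) : pullback id α = α := by
  funext x
  ext v
  have : mfderiv (𝓡 (2 * n + 1)) (𝓡 (2 * n + 1)) (id : M → M) x v = v := by
    rw [mfderiv_id]; rfl
  exact congrArg (α x) this

theorem pullback_symm_pullback (ψ : M ≃ₘ^∞⟮𝓡 (2 * n + 1), 𝓡 (2 * n + 1)⟯ M) (α : OneForm n M) :
    pullback ψ.symm (pullback ψ α) = α := by
  rw [pullback_pullback (ψ.symm.mdifferentiable (by simp)) (ψ.mdifferentiable (by simp)),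
    show ψ ∘ ψ.symm = id from funext ψ.apply_symm_apply, pullback_id]

theorem pullback_pullback_symm (ψ : M ≃ₘ^∞⟮𝓡 (2 * n + 1), 𝓡 (2 * n + 1)⟯ M) (α : OneForm n M) :
    pullback ψ (pullback ψ.symm α) = α := pullback_symm_pullback ψ.symm α

theorem pullback_symm_eq {ψ : M ≃ₘ^∞⟮𝓡 (2 * n + 1), 𝓡 (2 * n + 1)⟯ M} {lam : OneForm n M}
    (hψ : pullback ψ lam = lam) : pullback ψ.symm lam = lam := by
  conv_lhs => rw [← hψ]
  exact pullback_symm_pullback ψ lam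

variable [IsManifold (𝓡 (2 * n + 1)) ∞ M] {lam : OneForm n M}
  {ψ : M ≃ₘ^∞⟮𝓡 (2 * n + 1), 𝓡 (2 * n + 1)⟯ M}

/-- The pushed-forward vector satisfies both defining equations of R at ψ(x); surjectivity of dψ
lets every test vector `w` be pulled back. -/
theorem IsContactForm.mfderiv_reeb (h : IsContactForm lam) (hψ : pullback ψ lam = lam) (x : M) :
    mfderiv (𝓡 (2 * n + 1)) (𝓡 (2 * n + 1)) ψ x (reeb lam x) = reeb lam (ψ x) := by
  refine h.eq_reeb ?_ fun w => ?_
  · exact (congrArg (fun θ : OneForm n M => θ x (reeb lam x)) hψ).trans (h.apply_reeb x)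
  · obtain ⟨u, rfl⟩ : ∃ u : TangentSpace (𝓡 (2 * n + 1)) x,
        mfderiv (𝓡 (2 * n + 1)) (𝓡 (2 * n + 1)) ψ x u = w := by
      have h1 := mfderiv_comp_apply (ψ x) (ψ.mdifferentiable (by simp) (ψ.symm (ψ x)))
        (ψ.symm.mdifferentiable (by simp) (ψ x)) w
      rw [show ψ ∘ ψ.symm = id from funext ψ.apply_symm_apply, mfderiv_id] at h1
      rw [ψ.symm_apply_apply] at h1
      exact ⟨_, h1.symm⟩
    rw [← extD_pullback ψ.contMDiff h.smooth, hψ]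
    exact h.extD_reeb x _

/-- If `α (R) ∘ ψ⁻¹ - α (R) = R [H]`, then `α` lies in the image of `dΠ (λ, ψ)`. -/
theorem IsContactForm.exists_mem_tangentStrict [MeasurableSpace M] (h : IsContactForm lam)
    (hψ : pullback ψ lam = lam) {α : OneForm n M} (hα : α ∈ TangentForms lam) {H : M → ℝ}
    (hH : ContMDiff (𝓡 (2 * n + 1)) 𝓘(ℝ, ℝ) ∞ H)
    (hαH : ∀ x, α (ψ.symm x) (reeb lam (ψ.symm x)) - α x (reeb lam x) = dirDeriv (reeb lam) H x) :
    ∃ X : VField n M, (α, X) ∈ TangentStrict lam ψ := by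
  -- θ is the value L_X λ must take in order that ψ^*(α + L_X λ) = α.
  set θ : OneForm n M := pullback ψ.symm α - α with hθ
  have hθs : SmoothForm θ := (hα.1.pullback ψ.symm.contMDiff).sub hα.1
  have hθR : ∀ x, θ x (reeb lam x) = dForm H x (reeb lam x) := by
    intro x
    rw [← dirDeriv_eq, ← hαH]
    refine congrArg (fun r => r - α x (reeb lam x)) ?_
    exact congrArg (α (ψ.symm x)) (h.mfderiv_reeb (pullback_symm_eq hψ) x)
  -- The right-hand side θ − dH + Hλ encodes λ(X) = H and X ⌟ dλ = θ − dH at once; evaluation at R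
  -- separates the two, since θ(R) = dH(R).
  obtain ⟨X, hX, hXe⟩ := h.exists_contactBilin_eq
    ((hθs.sub (smoothForm_dForm hH)).add (h.smooth.fun_smul hH))
  have hXe' : ∀ x w, extD lam x (X x) w + lam x (X x) * lam x w =
      θ x w - dForm H x w + H x * lam x w := hXe
  have hlX : ∀ x, lam x (X x) = H x := by
    intro x
    have := hXe' x (reeb lam x)
    rwa [h.extD_reeb_right, h.apply_reeb, hθR, sub_self, zero_add, zero_add, mul_one, mul_one]
      at this
  have hL : lieForm X lam = θ := by
    funext x
    ext w
    have h1 := hXe' x w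
    rw [hlX, add_left_inj] at h1
    have h2 : lieForm X lam x w = dForm H x w + extD lam x (X x) w := by
      rw [lieForm, funext hlX]
      rfl
    rw [h2, h1]
    ring
  refine ⟨X, h.mem_tangentStrict ψ.contMDiff hψ hα hX (hL ▸ hθs) ?_⟩
  rw [hL, hθ, add_sub_cancel, pullback_pullback_symm]

end Construction

/-! ### The cokernel -/

section Functions

variable {n : ℕ} {M : Type*} [TopologicalSpace M] [ChartedSpace (Model n) M] {lam : OneForm n M}

theorem dirDeriv_sub {X : VField n M} {f g : M → ℝ}
    (hf : ContMDiff (𝓡 (2 * n + 1)) 𝓘(ℝ, ℝ) ∞ f) (hg : ContMDiff (𝓡 (2 * n + 1)) 𝓘(ℝ, ℝ) ∞ g)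
    (x : M) : dirDeriv X (fun y => f y - g y) x = dirDeriv X f x - dirDeriv X g x := by
  rw [dirDeriv, mvfderiv_fun_sub (hf.mdifferentiableAt (by simp))
    (hg.mdifferentiableAt (by simp))]
  rfl

theorem dirDeriv_reeb_comp {φ : M → M}
    (hφ : ContMDiff (𝓡 (2 * n + 1)) (𝓡 (2 * n + 1)) ∞ φ)
    (hR : ∀ x, mfderiv (𝓡 (2 * n + 1)) (𝓡 (2 * n + 1)) φ x (reeb lam x) = reeb lam (φ x))
    {K : M → ℝ} (hK : ContMDiff (𝓡 (2 * n + 1)) 𝓘(ℝ, ℝ) ∞ K) (x : M) :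
    dirDeriv (reeb lam) (fun y => K (φ y)) x = dirDeriv (reeb lam) K (φ x) := by
  have := mvfderiv_comp_apply x (hK.mdifferentiableAt (by simp) (x := φ x))
    (hφ.mdifferentiableAt (by simp)) (reeb lam x)
  rw [dirDeriv, dirDeriv, ← hR]
  exact this

theorem integrable_of_contMDiff [MeasurableSpace M] [BorelSpace M] [CompactSpace M]
    [IsFiniteMeasure (contactMeasure lam)] {f : M → ℝ}
    (hf : ContMDiff (𝓡 (2 * n + 1)) 𝓘(ℝ, ℝ) ∞ f) : Integrable f (contactMeasure lam) :=
  hf.continuous.integrable_of_hasCompactSupport (HasCompactSupport.of_compactSpace _)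

end Functions

/-! ### Vanishing of the smooth cokernel -/

section Cokernel

variable {n : ℕ} {M : Type*} [TopologicalSpace M] [ChartedSpace (Model n) M]
  [IsManifold (𝓡 (2 * n + 1)) ∞ M] {lam β : OneForm n M} {J : EndField n M}

theorem IsContactTriad.lam_sharp (h : IsContactForm lam) (hJ : IsContactTriad lam J)
    (β : OneForm n M) (x : M) : lam x (sharp lam J β x) = β x (StrictContact.reeb lam x) := by
  rw [← hJ.sharp_spec h β x, triadMetric, hJ.reeb, h.apply_reeb, map_zero, zero_add, mul_one]

theorem IsContactTriad.sharp_zero (h : IsContactForm lam) (hJ : IsContactTriad lam J) (x : M) :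
    sharp lam J 0 x = 0 :=
  hJ.triadBilin_nondegenerate h x _ fun w => hJ.sharp_spec h 0 x w

theorem IsContactTriad.l2Pairing_zero [MeasurableSpace M] (h : IsContactForm lam)
    (hJ : IsContactTriad lam J) (α : OneForm n M) : l2Pairing lam J α 0 = 0 := by
  simp [l2Pairing, hJ.sharp_zero h]

theorem zero_mem_tangentForms [MeasurableSpace M] : (0 : OneForm n M) ∈ TangentForms lam := by
  refine ⟨smoothForm_zero, ?_⟩
  simp

variable [MeasurableSpace M] [BorelSpace M] [CompactSpace M]

theorem IsContactForm.eq_zero_of_integral_eq_zero (h : IsContactForm lam)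
    [IsFiniteMeasure (contactMeasure lam)] {f : M → ℝ}
    (hf : ContMDiff (𝓡 (2 * n + 1)) 𝓘(ℝ, ℝ) ∞ f) (h0 : ∀ x, 0 ≤ f x)
    (hint : ∫ x, f x ∂(contactMeasure lam) = 0) (x : M) : f x = 0 := by
  have := h.isOpenPosMeasure
  have h1 := (integral_eq_zero_iff_of_nonneg h0 (integrable_of_contMDiff hf)).1 hint
  exact congrFun ((hf.continuous.ae_eq_iff_eq _ continuous_const).1 h1) x

/-- A form which is orthogonal to `α` for all `α` with `α (R) = 0` is a multiple of `λ`. -/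
theorem IsContactTriad.eq_smul_of_orthogonal (h : IsContactForm lam) (hJ : IsContactTriad lam J)
    [IsFiniteMeasure (contactMeasure lam)] (hβ : SmoothForm β)
    (horth : l2Pairing lam J (proj lam β) β = 0) (x : M) :
    β x = β x (StrictContact.reeb lam x) • lam x := by
  set Y := sharp lam J β with hY
  have hYs : SmoothField Y := hJ.smooth_sharp h hβ
  have hb : ContMDiff (𝓡 (2 * n + 1)) 𝓘(ℝ, ℝ) ∞ fun x => β x (StrictContact.reeb lam x) :=
    hβ.contMDiff_apply h.smooth_reeb
  have hps : SmoothForm (proj lam β) := hβ.sub (h.smooth.fun_smul hb)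
  -- The integrand ⟨β^π, β⟩ is the squared length of the ξ-component of β^♯, so a zero integral
  -- forces β^♯ to be a multiple of R.
  have hval : ∀ x, proj lam β x (Y x) = extD lam x (Y x) (J x (Y x)) := by
    intro x
    have h1 := hJ.sharp_spec h β x (Y x)
    have h2 := hJ.lam_sharp h β x
    rw [← hY] at h1 h2
    change β x (Y x) - β x (StrictContact.reeb lam x) * lam x (Y x) = _
    rw [← h1, ← h2, triadMetric]
    ring
  have hzero := h.eq_zero_of_integral_eq_zero (hps.contMDiff_apply hYs)
    (fun x => by rw [hval]; exact (hJ.extD_self h x _).1) horth x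
  rw [hval] at hzero
  have hYR := (hJ.extD_self h x _).2 hzero
  ext w
  have h1 := hJ.sharp_spec h β x w
  have h2 := hJ.lam_sharp h β x
  rw [← hY] at h1 h2
  have h3 : extD lam x (Y x) (J x w) = 0 := by
    rw [hYR, extD_skew, map_smul, h.extD_reeb_right, smul_zero, neg_zero]
  rw [← h1, triadMetric, h3, h2, zero_add]
  rfl

/-- The smooth `L²`-orthogonal complement of the image of `dΠ (λ, ψ)` is trivial. -/
theorem IsContactTriad.eq_zero_of_orthogonal [T2Space M] (h : IsContactForm lam)
    (hJ : IsContactTriad lam J) [IsFiniteMeasure (contactMeasure lam)]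
    {ψ : M ≃ₘ^∞⟮𝓡 (2 * n + 1), 𝓡 (2 * n + 1)⟯ M} (hψ : pullback ψ lam = lam)
    (hnp : NonProjectible lam) (hβ : β ∈ TangentForms lam)
    (horth : ∀ p ∈ TangentStrict lam ψ, l2Pairing lam J (dPi p) β = 0) : β = 0 := by
  set b : M → ℝ := fun x => β x (StrictContact.reeb lam x) with hb
  have hbs : ContMDiff (𝓡 (2 * n + 1)) 𝓘(ℝ, ℝ) ∞ b := hβ.1.contMDiff_apply h.smooth_reeb
  have hpR : ∀ x, proj lam β x (StrictContact.reeb lam x) = 0 := fun x => by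
    change β x (StrictContact.reeb lam x) - β x (StrictContact.reeb lam x) *
      lam x (StrictContact.reeb lam x) = 0
    rw [h.apply_reeb, mul_one, sub_self]
  have hβb : ∀ x, β x = b x • lam x := by
    refine hJ.eq_smul_of_orthogonal h hβ.1 ?_
    -- First test form: β^π(R) = 0, so H = 0 solves the cohomological equation and the mean-zero
    -- condition is automatic.
    obtain ⟨X, hX⟩ := h.exists_mem_tangentStrict hψ (α := proj lam β)
      ⟨hβ.1.sub (h.smooth.fun_smul hbs), by simp [hpR]⟩ (H := fun _ => 0) contMDiff_const
      (fun x => by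
        rw [hpR, hpR, dirDeriv, mvfderiv_const, sub_self]
        rfl)
    exact horth _ hX
  set K : M → ℝ := dirDeriv (StrictContact.reeb lam) b with hK
  have hKs : ContMDiff (𝓡 (2 * n + 1)) 𝓘(ℝ, ℝ) ∞ K := contMDiff_dirDeriv h.smooth_reeb hbs
  -- Second test form: α(R) = R[K] has mean zero by Stokes, and since ψ preserves R the difference
  -- α(R)∘ψ⁻¹ − α(R) is R[K∘ψ⁻¹ − K].
  set α : OneForm n M := fun x => dirDeriv (StrictContact.reeb lam) K x • lam x with hα
  have hKR := contMDiff_dirDeriv h.smooth_reeb hKs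
  have hαR : ∀ x, α x (StrictContact.reeb lam x) = dirDeriv (StrictContact.reeb lam) K x :=
    fun x => by
      change dirDeriv (StrictContact.reeb lam) K x * lam x (StrictContact.reeb lam x) = _
      rw [h.apply_reeb, mul_one]
  have hK' : ContMDiff (𝓡 (2 * n + 1)) 𝓘(ℝ, ℝ) ∞ (fun x => K (ψ.symm x)) :=
    hKs.comp ψ.symm.contMDiff
  obtain ⟨X, hX⟩ := h.exists_mem_tangentStrict hψ (α := α)
    ⟨h.smooth.fun_smul hKR, by simp_rw [hαR]; exact h.integral_dirDeriv_reeb hKs⟩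
    (H := fun x => K (ψ.symm x) - K x) (hK'.sub hKs) (fun x => by
      rw [hαR, hαR, dirDeriv_sub hK' hKs, dirDeriv_reeb_comp ψ.symm.contMDiff
        (h.mfderiv_reeb (pullback_symm_eq hψ)) hKs])
  have h1 : ∫ x, b x * dirDeriv (StrictContact.reeb lam) K x ∂(contactMeasure lam) = 0 := by
    rw [← horth _ hX, l2Pairing]
    congr 1
    funext x
    change _ = dirDeriv (StrictContact.reeb lam) K x * lam x (sharp lam J β x)
    rw [hJ.lam_sharp h β x, mul_comm]
  -- As K = R[b], the Leibniz rule gives R[Kb] = K² + b R[K], and the last term integrates to zero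
  -- by orthogonality.
  have h2 := h.integral_dirDeriv_reeb (hKs.mul hbs)
  have h3 : ∀ x, dirDeriv (StrictContact.reeb lam) (fun x => K x * b x) x =
      K x * K x + b x * dirDeriv (StrictContact.reeb lam) K x := fun x => dirDeriv_mul hKs hbs x
  have h4 : ∫ x, K x * K x ∂(contactMeasure lam) = 0 := by
    have h5 : ∫ x, (K x * K x + b x * dirDeriv (StrictContact.reeb lam) K x)
        ∂(contactMeasure lam) = 0 := by
      rw [← h2]
      exact integral_congr_ae (.of_forall fun x => (h3 x).symm)
    have i1 : Integrable (fun x => K x * K x) (contactMeasure lam) :=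
      integrable_of_contMDiff (hKs.mul hKs)
    have i2 : Integrable (fun x => b x * dirDeriv (StrictContact.reeb lam) K x)
        (contactMeasure lam) := integrable_of_contMDiff (hbs.mul hKR)
    rwa [integral_add i1 i2, h1, add_zero] at h5
  have h6 : ∀ x, K x = 0 := fun x => mul_self_eq_zero.1
    (h.eq_zero_of_integral_eq_zero (hKs.mul hKs) (fun x => mul_self_nonneg _) h4 x)
  have hb0 : b = 0 := by
    have : b ∈ ({0} : Set (M → ℝ)) := hnp ▸ ⟨hbs, h6, hβ.2⟩
    exact this
  funext x
  rw [hβb x, hb0]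
  exact zero_smul ℝ (lam x)

end Cokernel

/-! ### Countably many tangent vectors detect orthogonality -/

section Separability

variable {n : ℕ} {M : Type*} [TopologicalSpace M] [ChartedSpace (Model n) M]
  [IsManifold (𝓡 (2 * n + 1)) ∞ M]

/-- A chart of TM contains the whole fibre over its base chart domain, so charts at countably many
zero vectors suffice. This serves to make C(TM, ℝ) second countable. -/
theorem secondCountableTopology_tangentBundle [CompactSpace M] :
    SecondCountableTopology (TangentBundle (𝓡 (2 * n + 1)) M) := by
  have : SecondCountableTopology (ModelProd (Model n) (Model n)) :=
    inferInstanceAs (SecondCountableTopology (Model n × Model n))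
  obtain ⟨t, ht, hcover⟩ := countable_cover_nhds_of_sigmaCompact
    fun x : M => chart_source_mem_nhds (Model n) x
  refine ChartedSpace.secondCountable_of_countable_cover (ModelProd (Model n) (Model n))
    (s := (fun x => (⟨x, 0⟩ : TangentBundle (𝓡 (2 * n + 1)) M)) '' t) ?_ (ht.image _)
  refine eq_univ_of_forall fun v => ?_
  have hv : v.1 ∈ ⋃ x ∈ t, (chartAt (Model n) x).source := hcover ▸ mem_univ _
  obtain ⟨x, hx, hv⟩ := mem_iUnion₂.1 hv
  exact mem_iUnion₂.2 ⟨⟨x, 0⟩, mem_image_of_mem _ hx, (TangentBundle.mem_chart_source_iff _ _).2 hv⟩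

theorem locallyCompactSpace_tangentBundle :
    LocallyCompactSpace (TangentBundle (𝓡 (2 * n + 1)) M) := by
  have : LocallyCompactSpace (ModelProd (Model n) (Model n)) :=
    inferInstanceAs (LocallyCompactSpace (Model n × Model n))
  exact ChartedSpace.locallyCompactSpace (ModelProd (Model n) (Model n)) _

/-- A smooth one-form as a continuous function on the tangent bundle. -/
def SmoothForm.toContinuousMap {α : OneForm n M} (hα : SmoothForm α) :
    C(TangentBundle (𝓡 (2 * n + 1)) M, ℝ) where
  toFun v := α v.1 v.2
  continuous_toFun := by
    have : ContMDiff (𝓡 (2 * n + 1)).tangent 𝓘(ℝ, ℝ) ∞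
        fun v : TangentBundle (𝓡 (2 * n + 1)) M => α v.1 v.2 := fun v =>
      hα.contMDiffWithinAt_apply (f := fun v : TangentBundle (𝓡 (2 * n + 1)) M => v.1)
        (X := fun v => v.2) contMDiff_id.contMDiffAt
    exact this.continuous

/-- Restricting to the section β^♯ is continuous into C(M, ℝ) for the compact-open topologies, and
integration over the compact `M` against a finite measure is continuous there. -/
theorem IsContactTriad.continuous_integral_sharp [MeasurableSpace M] [BorelSpace M] [CompactSpace M]
    {lam β : OneForm n M} {J : EndField n M} (h : IsContactForm lam) (hJ : IsContactTriad lam J)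
    [IsFiniteMeasure (contactMeasure lam)] (hβ : SmoothForm β) :
    Continuous fun F : C(TangentBundle (𝓡 (2 * n + 1)) M, ℝ) =>
      ∫ x, F ⟨x, sharp lam J β x⟩ ∂(contactMeasure lam) := by
  let s : C(M, TangentBundle (𝓡 (2 * n + 1)) M) :=
    ⟨fun x => ⟨x, sharp lam J β x⟩, (hJ.smooth_sharp h hβ).continuous⟩
  have h1 : Continuous fun F : C(M, ℝ) => ∫ x, F x ∂(contactMeasure lam) := by
    have := (ContinuousMap.toLp (E := ℝ) 1 (contactMeasure lam) ℝ).continuous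
    refine (MeasureTheory.continuous_integral.comp this).congr fun F => ?_
    exact integral_congr_ae (ContinuousMap.coeFn_toLp _ F)
  exact h1.comp (ContinuousMap.continuous_precomp s)

/-- The orthogonal complement of a set of smooth one-forms is the orthogonal complement of a
countable subset. -/
theorem IsContactTriad.exists_seq_orthogonal [MeasurableSpace M] [BorelSpace M] [CompactSpace M]
    {lam : OneForm n M} {J : EndField n M} (h : IsContactForm lam) (hJ : IsContactTriad lam J)
    [IsFiniteMeasure (contactMeasure lam)] {S : Set (OneForm n M × VField n M)}
    (hS : S.Nonempty) (hsmooth : ∀ p ∈ S, SmoothForm p.1) :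
    ∃ p : ℕ → OneForm n M × VField n M, (∀ j, p j ∈ S) ∧ ∀ β, SmoothForm β →
      (∀ j, l2Pairing lam J (p j).1 β = 0) → ∀ q ∈ S, l2Pairing lam J q.1 β = 0 := by
  have := secondCountableTopology_tangentBundle (n := n) (M := M)
  have := locallyCompactSpace_tangentBundle (n := n) (M := M)
  let F : S → C(TangentBundle (𝓡 (2 * n + 1)) M, ℝ) := fun p => (hsmooth p.1 p.2).toContinuousMap
  -- Density is taken in the range of `F` itself, so that the members of the dense sequence come
  -- from pairs in `S`.
  have : Nonempty (range F) := have := hS.to_subtype; inferInstance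
  have hd := TopologicalSpace.denseRange_denseSeq (range F)
  choose p hp using fun j => (TopologicalSpace.denseSeq (range F) j).2
  refine ⟨fun j => (p j).1, fun j => (p j).2, fun β hβ hj q hq => ?_⟩
  have hc := (hJ.continuous_integral_sharp h hβ).comp (continuous_subtype_val (p := (· ∈ range F)))
  have := hd.equalizer hc (continuous_const (y := (0 : ℝ))) (by
    funext j
    simp only [Function.comp_apply]
    rw [← hp j]
    exact hj j)
  exact congrFun this ⟨F ⟨q, hq⟩, mem_range_self _⟩

end Separability

/-! ### Smooth tangent vectors are of class `C^(1,ε)` when `ε` decays fast -/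

section Floer

variable {n : ℕ}

theorem isCompact_closedCube (r : ℝ) : IsCompact (closedCube n r) := by
  have h : IsCompact ((EuclideanSpace.equiv (Fin (2 * n + 1)) ℝ) ⁻¹' Metric.closedBall 0 |r|) :=
    (EuclideanSpace.equiv (Fin (2 * n + 1)) ℝ).toHomeomorph.isCompact_preimage.2
      (isCompact_closedBall _ _)
  refine h.of_isClosed_subset ?_ fun y hy => ?_
  · rw [closedCube, ofPred_forall]
    exact isClosed_iInter fun i => isClosed_le (by fun_prop) continuous_const
  · rw [mem_preimage, mem_closedBall_zero_iff, pi_norm_le_iff_of_nonneg (abs_nonneg r)]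
    exact fun i => (hy i).trans (le_abs_self r)

theorem derivNorm_lt_top {r : ℝ} {f : Model n → ℝ} {U : Set (Model n)} (hU : IsOpen U)
    (hf : ContDiffOn ℝ ∞ f U) (hr : closedCube n r ⊆ U) (k : ℕ) : derivNorm r k f < ⊤ := by
  have hc : ContinuousOn (iteratedFDeriv ℝ k f) U :=
    (hf.continuousOn_iteratedFDerivWithin (m := k) (by exact_mod_cast le_top)
      hU.uniqueDiffOn).congr fun y hy => (iteratedFDerivWithin_of_isOpen k hU hy).symm
  obtain ⟨C, hC⟩ := (isCompact_closedCube r).exists_bound_of_continuousOn (hc.mono hr)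
  refine lt_of_le_of_lt (b := ENNReal.ofReal C) ?_ ENNReal.ofReal_lt_top
  refine iSup₂_le fun y hy => iSup_le fun I => ?_
  rw [← ofReal_norm]
  refine ENNReal.ofReal_le_ofReal (le_trans ?_ (hC y fun i => (hy i).le))
  refine ((iteratedFDeriv ℝ k f y).le_opNorm _).trans ?_
  simp

theorem derivNorm_zero (r : ℝ) (k : ℕ) : derivNorm r k (0 : Model n → ℝ) = 0 := by
  simp [derivNorm]

variable {M : Type*} [TopologicalSpace M] [ChartedSpace (Model n) M]
  [IsManifold (𝓡 (2 * n + 1)) ∞ M] {lam : OneForm n M}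

theorem DarbouxAtlas.derivNorm_formCoord_lt_top (𝔄 : DarbouxAtlas lam) {α : OneForm n M}
    (hα : SmoothForm α) (a : Fin 𝔄.N) (i : Fin (2 * n + 1)) (k : ℕ) :
    derivNorm (𝔄.radius a) k (formCoord (𝔄.chart a) α i) < ⊤ :=
  derivNorm_lt_top (𝔄.chart a).open_target
    ((hα.contDiffOn_comp (𝔄.chart a).open_target
      (contMDiffOn_symm_of_mem_maximalAtlas (𝔄.smooth a))).clm_apply contDiffOn_const)
    (𝔄.cube_subset a) k

theorem DarbouxAtlas.derivNorm_fieldCoord_lt_top (𝔄 : DarbouxAtlas lam) {X : VField n M}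
    (hX : SmoothField X) (a : Fin 𝔄.N) (i : Fin (2 * n + 1)) (k : ℕ) :
    derivNorm (𝔄.radius a) k (fieldCoord (𝔄.chart a) X i) < ⊤ :=
  derivNorm_lt_top (𝔄.chart a).open_target
    ((EuclideanSpace.proj (𝕜 := ℝ) i).contDiff.comp_contDiffOn
      (contDiffOn_mfderiv_apply
        (hX.comp_contMDiffOn (contMDiffOn_symm_of_mem_maximalAtlas (𝔄.smooth a)))
        (𝔄.chart a).open_source (contMDiffOn_of_mem_maximalAtlas (𝔄.smooth a))
        (𝔄.chart a).mapsTo_symm))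
    (𝔄.cube_subset a) k

theorem zero_mem_C1EpsForms (𝔄 : DarbouxAtlas lam) (ε : ℕ → ℝ≥0) :
    (0 : OneForm n M) ∈ C1EpsForms 𝔄 ε := by
  intro a i
  have : formCoord (𝔄.chart a) (0 : OneForm n M) i = 0 := rfl
  simp [IsC1Eps, this, derivNorm_zero]

/-- A diagonal sequence: for `ε ≤ ε₀` all of the series `∑ ε_k c_{j,k}` converge. -/
theorem exists_summable_diagonal (c : ℕ → ℕ → ℝ≥0∞) (hc : ∀ j k, c j k < ⊤) :
    ∃ ε₀ : ℕ → ℝ≥0, (∀ k, 0 < ε₀ k) ∧ ∀ ε : ℕ → ℝ≥0, (∀ k, ε k ≤ ε₀ k) →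
      ∀ j, ∑' k, (ε k : ℝ≥0∞) * c j k < ⊤ := by
  have hm : ∀ k, (∑ j ∈ Finset.range (k + 1), c j k) < ⊤ := fun k =>
    ENNReal.sum_lt_top.2 fun j _ => hc j k
  -- ε₀ k is matched to the rows j ≤ k only. Row j is then dominated by a geometric series from k =
  -- j on, and its first j terms are finite.
  choose ε₀ hε₀ using fun k => ENNReal.exists_nnreal_pos_mul_lt (hm k).ne
    (b := 2⁻¹ ^ k) (by simp)
  refine ⟨ε₀, fun k => (hε₀ k).1, fun ε hε j => ?_⟩
  rw [← ENNReal.summable.sum_add_tsum_nat_add' (f := fun k => (ε k : ℝ≥0∞) * c j k) (k := j)]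
  refine ENNReal.add_lt_top.2 ⟨ENNReal.sum_lt_top.2 fun k _ =>
    ENNReal.mul_lt_top ENNReal.coe_lt_top (hc j k), ?_⟩
  have hle : ∀ k, (ε (k + j) : ℝ≥0∞) * c j (k + j) ≤ 2⁻¹ ^ k := fun k =>
    calc (ε (k + j) : ℝ≥0∞) * c j (k + j)
        ≤ ε₀ (k + j) * ∑ i ∈ Finset.range (k + j + 1), c i (k + j) := by
          gcongr
          · exact hε _
          · exact Finset.single_le_sum (f := fun i => c i (k + j)) (fun _ _ => zero_le)
              (Finset.mem_range.2 (by omega))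
      _ ≤ 2⁻¹ ^ (k + j) := (hε₀ (k + j)).2.le
      _ ≤ 2⁻¹ ^ k := pow_le_pow_right_of_le_one' (by simp) (by omega)
  refine (ENNReal.tsum_le_tsum hle).trans_lt ?_
  rw [ENNReal.tsum_geometric, ENNReal.one_sub_inv_two, inv_inv]
  exact ENNReal.ofNat_lt_top

/-- Countably many smooth pairs are of class `C^(1,ε)` for all sufficiently small `ε`. -/
theorem DarbouxAtlas.exists_eps (𝔄 : DarbouxAtlas lam) (p : ℕ → OneForm n M × VField n M)
    (hp : ∀ j, SmoothForm (p j).1 ∧ SmoothField (p j).2) :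
    ∃ ε₀ : ℕ → ℝ≥0, (∀ k, 0 < ε₀ k) ∧ ∀ ε : ℕ → ℝ≥0, (∀ k, ε k ≤ ε₀ k) →
      ∀ j, (p j).1 ∈ C1EpsForms 𝔄 ε ∧ (p j).2 ∈ C1EpsFields 𝔄 ε := by
  let d (j k : ℕ) (a : Fin 𝔄.N) (i : Fin (2 * n + 1)) : ℝ≥0∞ :=
    derivNorm (𝔄.radius a) k (formCoord (𝔄.chart a) (p j).1 i) +
      derivNorm (𝔄.radius a) k (fieldCoord (𝔄.chart a) (p j).2 i)
  have hd : ∀ j k a i, d j k a i < ⊤ := fun j k a i => ENNReal.add_lt_top.2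
    ⟨𝔄.derivNorm_formCoord_lt_top (hp j).1 a i k, 𝔄.derivNorm_fieldCoord_lt_top (hp j).2 a i k⟩
  -- Orders k and k+1 are summed together because `IsC1Eps` weighs both with ε k; the finite sums
  -- run over charts and components.
  obtain ⟨ε₀, hpos, hε₀⟩ := exists_summable_diagonal
    (fun j k => ∑ a, ∑ i, (d j k a i + d j (k + 1) a i)) fun j k =>
      ENNReal.sum_lt_top.2 fun a _ => ENNReal.sum_lt_top.2 fun i _ =>
        ENNReal.add_lt_top.2 ⟨hd j k a i, hd j (k + 1) a i⟩
  have hle : ∀ j k a i, d j k a i + d j (k + 1) a i ≤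
      ∑ a, ∑ i, (d j k a i + d j (k + 1) a i) := fun j k a i =>
    (Finset.single_le_sum (f := fun i => d j k a i + d j (k + 1) a i)
      (fun _ _ => zero_le) (Finset.mem_univ i)).trans
      (Finset.single_le_sum (f := fun a => ∑ i, (d j k a i + d j (k + 1) a i))
        (fun _ _ => zero_le) (Finset.mem_univ a))
  refine ⟨ε₀, hpos, fun ε hε j => ?_⟩
  have key : ∀ (u : ℕ → ℝ≥0∞) (a : Fin 𝔄.N) (i : Fin (2 * n + 1)),
      (∀ k, u k ≤ d j k a i + d j (k + 1) a i) → ∑' k, (ε k : ℝ≥0∞) * u k < ⊤ :=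
    fun u a i hu => (ENNReal.tsum_le_tsum fun k =>
      mul_le_mul_right ((hu k).trans (hle j k a i)) _).trans_lt (hε₀ ε hε j)
  exact ⟨fun a i => ⟨key _ a i fun k => le_self_add.trans le_self_add,
      key _ a i fun k => le_self_add.trans le_add_self⟩,
    fun a i => ⟨key _ a i fun k => le_add_self.trans le_self_add,
      key _ a i fun k => le_add_self.trans le_add_self⟩⟩

end Floer

end StrictContact

end

open StrictContact in
/-- The linearized projection `dΠ` at a strict contact pair `(lam, ψ)` with `lam` non-projectible has
trivial `L²`-cokernel, both on smooth tangent vectors and on those of class `C^(1,ε)` for all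
sequences `ε` which decay sufficiently fast. -/
theorem proposition7p5 (n : ℕ) (M : Type*) [TopologicalSpace M] [ChartedSpace (Model n) M]
    [IsManifold (𝓡 (2 * n + 1)) ∞ M] [CompactSpace M] [T2Space M]
    [MeasurableSpace M] [BorelSpace M]
    (lam : OneForm n M) (ψ : M ≃ₘ^∞⟮𝓡 (2 * n + 1), 𝓡 (2 * n + 1)⟯ M)
    (hpair : (lam, ψ) ∈ StrictContactPairs) (hnp : NonProjectible lam)
    (J : EndField n M) (hJ : IsContactTriad lam J) :
    cokerDPi lam ψ J = {0} ∧
    ∀ 𝔄 : DarbouxAtlas lam, ∃ ε₀ : ℕ → ℝ≥0, (∀ k, 0 < ε₀ k) ∧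
      ∀ ε : ℕ → ℝ≥0, (∀ k, 0 < ε k ∧ ε k ≤ ε₀ k) → cokerDPiEps 𝔄 ε ψ J = {0} := by
  obtain ⟨⟨h, hvol⟩, hψ⟩ := hpair
  change IsContactForm lam at h
  change contactMeasure lam univ = 1 at hvol
  change pullback ψ lam = lam at hψ
  have : IsFiniteMeasure (contactMeasure lam) := ⟨by rw [hvol]; exact ENNReal.one_lt_top⟩
  refine ⟨Subset.antisymm ?_ ?_, fun 𝔄 => ?_⟩
  · rintro β ⟨hβ, horth⟩
    exact hJ.eq_zero_of_orthogonal h hψ hnp hβ horth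
  · rintro _ rfl
    exact ⟨zero_mem_tangentForms, fun p _ => hJ.l2Pairing_zero h _⟩
  have hne : (TangentStrict lam ψ).Nonempty := by
    obtain ⟨X, hX⟩ := h.exists_mem_tangentStrict hψ (α := 0) zero_mem_tangentForms
      (H := fun _ => 0) contMDiff_const fun x => by
        rw [dirDeriv, mvfderiv_const]
        exact sub_self (0 : ℝ)
    exact ⟨_, hX⟩
  -- The countable test family is fixed before any β, so one ε₀ serves all of them.
  obtain ⟨p, hp, hdense⟩ := hJ.exists_seq_orthogonal h hne fun p hp => hp.1.1.1
  obtain ⟨ε₀, hpos, hε₀⟩ := 𝔄.exists_eps p fun j => ⟨(hp j).1.1.1, (hp j).1.2.1⟩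
  refine ⟨ε₀, hpos, fun ε hε => Subset.antisymm ?_ ?_⟩
  · rintro β ⟨hβ, -, horth⟩
    have hmem := hε₀ ε fun k => (hε k).2
    -- Orthogonality to the family extends to all smooth tangent pairs, which reduces the claim to
    -- the smooth cokernel.
    exact hJ.eq_zero_of_orthogonal h hψ hnp hβ
      (hdense β hβ.1 fun j => horth _ (hp j) (hmem j).1 (hmem j).2)
  · rintro _ rfl
    exact ⟨zero_mem_tangentForms, zero_mem_C1EpsForms 𝔄 ε, fun p _ _ _ => hJ.l2Pairing_zero h _⟩
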